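/- Let $n\ge 1$ and let $S^n=\{x\in\mathbb{R}^{n+1} : \|x\|=1\}$ carry the geodesic metric $d(x,y)=\arccos(x\cdot y)$. For $r>0$ let $\check{C}(S^n;r)$ be the intrinsic Čech complex, i.e. the nerve of the family of all open balls $B(x,r)$, $x\in S^n$, identified with its geometric realization: its simplices are the non-empty finite sets $\sigma\subseteq S^n$ with $\bigcap_{x\in\sigma}B(x,r)\neq\emptyset$. For $m\ge 1$ let $\mathrm{cov}_{S^n}(m)$ be the infimum of all $r\ge 0$ such that $S^n$ is covered by $m$ closed balls of radius $r$. A non-empty space $Y$ is called $m$-connected if $\pi_i(Y)$ is trivial for all $0\le i\le m$, and $\mathrm{conn}(Y)$ denotes the maximal integer $m$ such that $Y$ is $m$-connected ($\mathrm{conn}(Y)=\infty$ if there is none; $\mathrm{conn}(Y)=-1$ if $Y$ is not path-connected). Let $\delta\in(0,\pi)$. Then: 1. For every integer $k\ge 0$, if $\mathrm{conn}(\check{C}(S^n;\pi-\delta))=k-1$, then $$\mathrm{cov}_{S^n}(2k+2)\le\delta\le 2\,\mathrm{cov}_{S^n}(k+1).$$ 2. For every integer $k\ge 0$, if $\delta<\mathrm{cov}_{S^n}(2k+2)$,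 then $\check{C}(S^n;\pi-\delta)$ is $k$-connected. 3. For every integer $k\ge 1$, if $\delta>2\,\mathrm{cov}_{S^n}(k+1)$, then $\mathrm{conn}(\check{C}(S^n;\pi-\delta))\le k-2$ (in particular the connectivity is finite). -/

import Mathlib

open scoped Topology

noncomputable section

/-- The unit sphere `S^n ⊆ ℝ^(n+1)`, as a type of its own, to carry the geodesic metric
(`Metric.sphere` itself carries the chordal one). -/
def GeodesicSphere (n : ℕ) : Type :=
  Metric.sphere (0 : EuclideanSpace ℝ (Fin (n + 1))) 1

namespace GeodesicSphere

variable {n : ℕ}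

/-- The underlying unit vector of a point of the sphere. -/
def vec (x : GeodesicSphere n) : EuclideanSpace ℝ (Fin (n + 1)) := Subtype.val x

theorem norm_vec (x : GeodesicSphere n) : ‖x.vec‖ = 1 :=
  mem_sphere_zero_iff_norm.mp (Subtype.property x)

theorem arccos_inner_eq_angle (x y : GeodesicSphere n) :
    Real.arccos (inner ℝ x.vec y.vec) = InnerProductGeometry.angle x.vec y.vec := by
  simp [InnerProductGeometry.angle, norm_vec]

/-- The geodesic metric `d(x, y) = arccos (x · y)`. -/
instance : MetricSpace (GeodesicSphere n) where
  dist x y := Real.arccos (inner ℝ x.vec y.vec)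
  dist_self x := by
    change Real.arccos (inner ℝ x.vec x.vec) = 0
    rw [real_inner_self_eq_norm_sq, norm_vec]
    simp
  dist_comm x y := by
    change Real.arccos (inner ℝ x.vec y.vec) = Real.arccos (inner ℝ y.vec x.vec)
    rw [real_inner_comm]
  dist_triangle x y z := by
    change Real.arccos (inner ℝ x.vec z.vec) ≤
      Real.arccos (inner ℝ x.vec y.vec) + Real.arccos (inner ℝ y.vec z.vec)
    simp only [arccos_inner_eq_angle]
    exact InnerProductGeometry.angle_le_angle_add_angle _ _ _
  eq_of_dist_eq_zero := by
    intro x y h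
    have h1 : 1 ≤ inner ℝ x.vec y.vec := Real.arccos_eq_zero.mp h
    have h2 : inner ℝ x.vec y.vec = (1 : ℝ) :=
      le_antisymm (by simpa [norm_vec] using real_inner_le_norm x.vec y.vec) h1
    exact Subtype.ext ((inner_eq_one_iff_of_norm_eq_one (norm_vec x) (norm_vec y)).mp h2)

theorem dist_eq (x y : GeodesicSphere n) :
    dist x y = Real.arccos (inner ℝ x.vec y.vec) := rfl

end GeodesicSphere

/-- The `k`-th covering radius of `X` (for `k ≥ 1`): the infimum of the `r ≥ 0` such that `k`
closed balls of radius `r` cover `X`. -/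
def covRadius (X : Type*) [MetricSpace X] (k : ℕ) : ℝ :=
  sInf {r : ℝ | 0 ≤ r ∧ ∃ x : Fin k → X, ⋃ i, Metric.closedBall (x i) r = Set.univ}

/-- The intrinsic Čech complex of `X` at scale `r`: the nerve of all open balls of radius `r`,
indexed by their centers. (For `r > 0` every singleton is a face.) -/
def cechComplex (X : Type*) [MetricSpace X] (r : ℝ) : PreAbstractSimplicialComplex X where
  faces := {σ | σ.Nonempty ∧ (⋂ x ∈ σ, Metric.ball x r).Nonempty}
  isRelLowerSet_faces := by
    rintro σ ⟨hσ, z, hz⟩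
    refine ⟨hσ, fun τ hτ hne => ⟨hne, z, ?_⟩⟩
    simp only [Set.mem_iInter] at hz ⊢
    exact fun x hx => hz x (hτ hx)

/-- The geometric realization of a simplicial complex: formal convex combinations of vertices
(barycentric coordinates) whose support is a face. -/
def Realization {V : Type*} (K : PreAbstractSimplicialComplex V) : Type _ :=
  {w : V →₀ ℝ // (∀ v, 0 ≤ w v) ∧ (w.sum fun _ a => a) = 1 ∧ w.support ∈ K}

namespace Realization

variable {V : Type*} {K : PreAbstractSimplicialComplex V}

/-- The barycentric coordinates of a point. -/
def coord (p : Realization K) : V →₀ ℝ := Subtype.val p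

/-- The closed simplex spanned by the vertex set `σ`. -/
def ClosedSimplex (K : PreAbstractSimplicialComplex V) (σ : Finset V) : Type _ :=
  {p : Realization K // p.coord.support ⊆ σ}

/-- The Euclidean topology of a closed simplex, given by the barycentric coordinates. -/
instance (σ : Finset V) : TopologicalSpace (ClosedSimplex K σ) :=
  TopologicalSpace.induced (fun p v => (Subtype.val p).coord v)
    (inferInstance : TopologicalSpace (V → ℝ))

/-- The weak (coherent) topology: the finest one for which the inclusions of all closed simplices
are continuous. -/
instance : TopologicalSpace (Realization K) :=
  ⨆ σ : K.faces, TopologicalSpace.coinduced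
    (fun p : ClosedSimplex K σ.1 => Subtype.val p) inferInstance

end Realization

/-- `Y` is `m`-connected: it is non-empty and `π_i(Y)` is trivial, at every base point, for all
`0 ≤ i ≤ m`. -/
def IsNConnected (Y : Type*) [TopologicalSpace Y] (m : ℤ) : Prop :=
  Nonempty Y ∧ ∀ i : ℕ, (i : ℤ) ≤ m → ∀ y : Y, Subsingleton (π_ i Y y)

/-- `conn(Y) = m`: the maximal index for which `Y` is `m`-connected is `m`. -/
def HasConnectivity (Y : Type*) [TopologicalSpace Y] (m : ℤ) : Prop :=
  IsGreatest {j : ℤ | IsNConnected Y j} m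

end

/-!
A set `σ` of points of `S^n` is a simplex of the Čech complex at scale `π - δ` exactly if some `w`
has distance greater than `δ` to all points of `σ`, namely the antipode of a common point of the
balls. So the complex is the neighborhood complex of the Borsuk graph, in which `x` and `w` are
adjacent if `δ < d(x, w)` (`GeodesicSphere.cechComplex_eq_neighborComplex`).

Connectivity from below: `δ < cov(m)` says that any `m` points have a common neighbor, so all sets
of at most `m` vertices are simplices. Such a complex has trivial homotopy groups in degrees up to
`m - 2` (`subsingleton_pi_of_card_le`): by a partition of unity subordinate to the preimages of open
stars in which at most `i + 1` functions are non-zero at a time, a map of the `i`-cube is deformed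
into the `i`-skeleton, over which there is room for a cone. The order of the partition comes from
`i + 1` shifted grids of cubes: a point lies on the walls of at most `i` of them
(`exists_gridBump_pos`).

Connectivity from above: if `2 cov(k + 1) < δ`, a covering by `k + 1` balls of diameter less than
`δ` colors the Borsuk graph with `k + 1` colors, and Lovász's theorem (`exists_not_subsingleton_pi`)
provides a non-trivial homotopy group in a degree less than `k`. Its proof uses pairs `(p, q)` of
convex combinations of vertices such that all vertices of `p` are adjacent to all vertices of `q`,
with the involution that swaps `p` and `q`. The projection to `p` is a homotopy equivalence to the
neighborhood complex with an explicit inverse (`IsBoxMap.core`, `IsBoxMap.homotopy`). Hence, if all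
homotopy groups in degrees less than `k` were trivial, odd maps of spheres to the space of pairs
could be extended dimension by dimension up to a map of the `k`-ball that is odd on its boundary
(`exists_odd_boxMap`). Comparing the weights that `p` and `q` give to the color classes turns it
into a nowhere vanishing map from the `k`-ball to `ℝ^k` that is odd on the boundary, contrary to the
Borsuk–Ulam theorem (`exists_eq_zero_of_odd`).

The Borsuk–Ulam theorem is proved with chains modulo two. The hemispheres of the iterated
subdivisions of the cross-polytope satisfy `∂ c (i + 1) = c i + (antipode of c i)`. The sign of each
coordinate of an odd map changes by one under the antipode, so the cup product of the coboundaries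
of the first `i` signs takes the same value on all `c i`, namely one
(`ListChain.eval_cupProduct_hemisphere`). For a map without zeros it vanishes on small simplices of
dimension `k`, since not all coordinates can change their sign there.

Maps into a realization are handled by coordinates: a compact family of points uses finitely many
vertices, and for such families continuity in the weak topology is continuity of the coordinates
(`Realization.exists_finset_support_subset`, `Realization.continuous_of_continuous_coord`).
-/

noncomputable section

/-! ### Ordered chains modulo two -/

/-- Chains modulo two on ordered tuples of points of `X`, augmented by the empty tuple: a list of
length `n + 1` is an `n`-simplex. -/
abbrev ListChain (X : Type*) := List X →₀ ZMod 2

namespace ListChain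

variable {X : Type*}

/-- The chains all of whose tuples satisfy `P`. -/
def SupportedOn (P : List X → Prop) : Submodule (ZMod 2) (ListChain X) :=
  Finsupp.supported (ZMod 2) (ZMod 2) {l | P l}

theorem single_mem {P : List X → Prop} {l : List X} (h : P l) :
    Finsupp.single l 1 ∈ SupportedOn P :=
  Finsupp.single_mem_supported _ _ h

theorem supportedOn_mono {P Q : List X → Prop} (h : ∀ l, P l → Q l) {c : ListChain X}
    (hc : c ∈ SupportedOn P) : c ∈ SupportedOn Q :=
  Finsupp.supported_mono (fun l hl => h l hl) hc

theorem map_mem {M : Type*} [AddCommGroup M] [Module (ZMod 2) M] {P : List X → Prop}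
    (f : ListChain X →ₗ[ZMod 2] M) (N : Submodule (ZMod 2) M)
    (h : ∀ l, P l → f (Finsupp.single l 1) ∈ N) {c : ListChain X} (hc : c ∈ SupportedOn P) :
    f c ∈ N := by
  rw [SupportedOn, Finsupp.supported_eq_span_single] at hc
  have : Submodule.span (ZMod 2) ((fun i => Finsupp.single i (1 : ZMod 2)) '' {l | P l}) ≤
      N.comap f := by
    rw [Submodule.span_le]
    rintro _ ⟨l, hl, rfl⟩
    exact h l hl
  exact this hc

theorem map_eq {M : Type*} [AddCommGroup M] [Module (ZMod 2) M] {P : List X → Prop}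
    (f g : ListChain X →ₗ[ZMod 2] M)
    (h : ∀ l, P l → f (Finsupp.single l 1) = g (Finsupp.single l 1)) {c : ListChain X}
    (hc : c ∈ SupportedOn P) : f c = g c := by
  have := map_mem (f - g) ⊥ (P := P) (fun l hl => by simp [h l hl]) hc
  simpa [sub_eq_zero] using this

/-- The cone with apex `b`, which puts `b` in front of every tuple. -/
def cone (b : X) : ListChain X →ₗ[ZMod 2] ListChain X :=
  Finsupp.lmapDomain _ _ (List.cons b)

@[simp] theorem cone_single (b : X) (l : List X) (a : ZMod 2) :
    cone b (Finsupp.single l a) = Finsupp.single (b :: l) a := by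
  simp [cone]

/-- The sum of the faces of a tuple. -/
def listBdry : List X → ListChain X
  | [] => 0
  | b :: l => Finsupp.single l 1 + cone b (listBdry l)

/-- The augmented boundary operator. -/
def bdry : ListChain X →ₗ[ZMod 2] ListChain X := Finsupp.linearCombination (ZMod 2) listBdry

@[simp] theorem bdry_single (l : List X) : bdry (Finsupp.single l 1) = listBdry l := by
  simp [bdry]

theorem bdry_cone (b : X) (c : ListChain X) : bdry (cone b c) = c + cone b (bdry c) := by
  have h : bdry ∘ₗ cone b = LinearMap.id + cone b ∘ₗ bdry := by
    ext1 l; ext1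
    simp [listBdry]
  exact congrArg (· c) h

theorem bdry_listBdry (l : List X) : bdry (listBdry l) = 0 := by
  induction l with
  | nil => simp [listBdry]
  | cons b l ih =>
    simp [listBdry, bdry_cone, ih, ZModModule.add_self]

theorem listBdry_mem (l : List X) :
    listBdry l ∈ SupportedOn (fun m => m.length + 1 = l.length ∧ m ⊆ l) := by
  induction l with
  | nil => exact Submodule.zero_mem _
  | cons b l ih =>
    refine Submodule.add_mem _ (single_mem (by simp)) (map_mem _ _ ?_ ih)
    rintro m ⟨h1, h2⟩
    rw [cone_single]
    refine single_mem ⟨by simp [h1], ?_⟩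
    intro x hx
    rcases List.mem_cons.1 hx with rfl | hx
    · simp
    · exact List.mem_cons_of_mem _ (h2 hx)

/-- A product of coboundaries of the functions `s n`, evaluated on a tuple: a vertex with `n ≥ 1`
vertices behind it contributes the change of `s n` between it and its successor. -/
def cupProduct (s : ℕ → X → ZMod 2) : List X → ZMod 2
  | [] => 0
  | [_] => 1
  | x :: y :: l => (s (l.length + 1) x + s (l.length + 1) y) * cupProduct s (y :: l)

/-- The value of the first function at the first vertex times `cupProduct`. -/
def primitive (s : ℕ → X → ZMod 2) : List X → ZMod 2
  | [] => 0
  | x :: l => s (l.length + 1) x * cupProduct s (x :: l)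

/-- The linear extension of a function on tuples. -/
abbrev eval (u : List X → ZMod 2) : ListChain X →ₗ[ZMod 2] ZMod 2 :=
  Finsupp.linearCombination (ZMod 2) u

/-- `cupProduct` is a cocycle. -/
theorem eval_cupProduct_listBdry (s : ℕ → X → ZMod 2) (l : List X) :
    eval (cupProduct s) (listBdry l) = 0 := by
  induction l with
  | nil => simp [listBdry]
  | cons x l ih =>
  match l, ih with
  | [], _ => simp [listBdry, cupProduct]
  | [y], _ =>
    simp only [listBdry, map_add, map_zero, cone_single, Finsupp.linearCombination_single,
      cupProduct, smul_eq_mul]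
    decide
  | y :: z :: l, ih =>
    have key : eval (cupProduct s) (cone x (cone y (listBdry (z :: l)))) =
        (s (l.length + 1) x + s (l.length + 1) y) *
          eval (cupProduct s) (cone y (listBdry (z :: l))) := by
      refine map_eq (eval (cupProduct s) ∘ₗ cone x ∘ₗ cone y)
        ((s (l.length + 1) x + s (l.length + 1) y) • (eval (cupProduct s) ∘ₗ cone y)) ?_
        (listBdry_mem (z :: l))
      rintro m ⟨hm, -⟩
      simp only [List.length_cons, add_left_inj] at hm
      simp [cupProduct, hm]
    have h2 : eval (cupProduct s) (cone y (listBdry (z :: l))) = cupProduct s (z :: l) := by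
      rw [listBdry, map_add, add_comm] at ih
      have := (eq_neg_of_add_eq_zero_left ih)
      rw [this, ZModModule.neg_eq_self]
      simp
    rw [listBdry, map_add, listBdry, map_add, map_add, key, h2]
    simp only [cone_single, Finsupp.linearCombination_single, cupProduct, one_smul]
    generalize s (l.length + 1) x = a
    generalize s (l.length + 1) y = b
    generalize s (l.length + 1) z = c
    generalize cupProduct s (z :: l) = d
    revert a b c d
    decide

theorem eval_primitive_listBdry (s : ℕ → X → ZMod 2) (l : List X) (hl : 2 ≤ l.length) :
    eval (primitive s) (listBdry l) = cupProduct s l := by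
  match l, hl with
  | x :: y :: l, _ =>
    have key : eval (primitive s) (cone x (listBdry (y :: l))) =
        s (l.length + 1) x * eval (cupProduct s) (cone x (listBdry (y :: l))) := by
      refine map_eq (eval (primitive s) ∘ₗ cone x)
        (s (l.length + 1) x • (eval (cupProduct s) ∘ₗ cone x)) ?_ (listBdry_mem (y :: l))
      rintro m ⟨hm, -⟩
      simp only [List.length_cons, add_left_inj] at hm
      simp [primitive, hm]
    have h2 := eval_cupProduct_listBdry s (x :: y :: l)
    rw [listBdry, map_add, add_comm] at h2
    have h3 := (eq_neg_of_add_eq_zero_left h2)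
    rw [ZModModule.neg_eq_self] at h3
    rw [listBdry, map_add, key, h3]
    simp only [Finsupp.linearCombination_single, one_smul, primitive, cupProduct]
    ring

/-- The action of the antipodal map on chains. -/
def antipode [Neg X] : ListChain X →ₗ[ZMod 2] ListChain X :=
  Finsupp.lmapDomain _ _ (List.map Neg.neg)

@[simp] theorem antipode_single [Neg X] (l : List X) (a : ZMod 2) :
    antipode (Finsupp.single l a) = Finsupp.single (l.map Neg.neg) a := by
  simp [antipode]

theorem antipode_cone [Neg X] (b : X) (c : ListChain X) :
    antipode (cone b c) = cone (-b) (antipode c) := by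
  have h : antipode ∘ₗ cone b = cone (-b) ∘ₗ antipode := by
    ext1 l; ext1
    simp
  exact congrArg (· c) h

theorem listBdry_map_neg [Neg X] (l : List X) :
    listBdry (l.map Neg.neg) = antipode (listBdry l) := by
  induction l with
  | nil => simp [listBdry]
  | cons b l ih => simp [listBdry, ih, antipode_cone]

theorem cupProduct_map_neg [Neg X] {s : ℕ → X → ZMod 2} {k : ℕ} {l : List X}
    (hl : l.length ≤ k + 1) (h : ∀ n, n ≤ k → ∀ x ∈ l, s n (-x) = s n x + 1) :
    cupProduct s (l.map Neg.neg) = cupProduct s l := by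
  induction l with
  | nil => rfl
  | cons x l ih =>
    match l, ih, hl, h with
    | [], _, _, _ => rfl
    | y :: l, ih, hl, h =>
      simp only [List.length_cons] at hl ih
      have := ih (by omega) (fun n hn z hz => h n hn z (List.mem_cons_of_mem _ hz))
      simp only [List.map_cons] at this ⊢
      simp only [cupProduct, this, List.length_map]
      rw [h _ (by omega) x (by simp), h _ (by omega) y (by simp)]
      congr 1
      generalize s (l.length + 1) x = a
      generalize s (l.length + 1) y = b
      revert a b
      decide

theorem primitive_add_primitive_neg [Neg X] {s : ℕ → X → ZMod 2} {k : ℕ} {l : List X}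
    (hl : l.length ≤ k) (h : ∀ n, n ≤ k → ∀ x ∈ l, s n (-x) = s n x + 1) :
    primitive s l + primitive s (l.map Neg.neg) = cupProduct s l := by
  match l, hl, h with
  | [], _, _ => rfl
  | x :: l, hl, h =>
    have h1 := cupProduct_map_neg (s := s) (k := k) (l := x :: l) (by omega) h
    simp only [List.map_cons, List.length_cons] at h1 hl ⊢
    simp only [primitive, h1, List.length_map]
    rw [h _ hl x (by simp)]
    generalize s (l.length + 1) x = a
    generalize cupProduct s (x :: l) = b
    revert a b
    decide

/-! ### Barycentric subdivision -/

variable {E : Type*} [NormedAddCommGroup E] [NormedSpace ℝ E]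

/-- The barycenter of a tuple of points. -/
def barycenter (l : List E) : E := (l.length : ℝ)⁻¹ • l.sum

/-- The barycentric subdivision of a tuple of length `n`; the value on tuples of other lengths is
irrelevant. -/
def subdivideAux : ℕ → List E → ListChain E
  | 0, l => Finsupp.single l 1
  | n + 1, l =>
    cone (barycenter l) (Finsupp.linearCombination (ZMod 2) (subdivideAux n) (listBdry l))

/-- Barycentric subdivision of chains. -/
def subdivide : ListChain E →ₗ[ZMod 2] ListChain E :=
  Finsupp.linearCombination (ZMod 2) fun l => subdivideAux l.length l

theorem subdivide_nil : subdivide (Finsupp.single ([] : List E) 1) = Finsupp.single [] 1 := by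
  simp [subdivide, subdivideAux]

theorem subdivide_single {l : List E} (hl : l ≠ []) :
    subdivide (Finsupp.single l 1) = cone (barycenter l) (subdivide (listBdry l)) := by
  obtain ⟨n, hn⟩ : ∃ n, l.length = n + 1 :=
    Nat.exists_eq_succ_of_ne_zero (by simpa using hl)
  simp only [subdivide, Finsupp.linearCombination_single, one_smul, hn, subdivideAux]
  congr 1
  refine map_eq _ _ ?_ (listBdry_mem l)
  rintro m ⟨hm, -⟩
  obtain rfl : m.length = n := by omega
  simp

theorem bdry_subdivide_single (n : ℕ) :
    ∀ l : List E, l.length = n →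
      bdry (subdivide (Finsupp.single l 1)) = subdivide (listBdry l) := by
  induction n with
  | zero =>
    intro l hl
    obtain rfl := List.eq_nil_of_length_eq_zero hl
    simp [subdivide_nil, listBdry]
  | succ n ih =>
    intro l hl
    have h1 : bdry (subdivide (listBdry l)) = subdivide (bdry (listBdry l)) := by
      refine map_eq (bdry ∘ₗ subdivide (E := E)) (subdivide ∘ₗ bdry (X := E)) (fun m hm => ?_)
        (listBdry_mem l)
      rw [LinearMap.comp_apply, LinearMap.comp_apply, bdry_single]
      exact ih m (by omega)
    rw [subdivide_single (by rintro rfl; simp at hl), bdry_cone, h1, bdry_listBdry]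
    simp

theorem bdry_subdivide (c : ListChain E) : bdry (subdivide c) = subdivide (bdry c) := by
  have h : bdry ∘ₗ subdivide = subdivide ∘ₗ (bdry (X := E)) := by
    ext1 l; ext1
    simpa using bdry_subdivide_single _ l rfl
  exact congrArg (· c) h

theorem barycenter_map_neg (l : List E) : barycenter (l.map Neg.neg) = -barycenter l := by
  have : (l.map Neg.neg).sum = -l.sum := by
    induction l with
    | nil => simp
    | cons a l ih => simp [ih, add_comm]
  simp [barycenter, this]

theorem subdivide_single_map_neg (n : ℕ) :
    ∀ l : List E, l.length = n →
      subdivide (Finsupp.single (l.map Neg.neg) 1) = antipode (subdivide (Finsupp.single l 1)) := by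
  induction n with
  | zero =>
    intro l hl
    obtain rfl := List.eq_nil_of_length_eq_zero hl
    simp [subdivide_nil]
  | succ n ih =>
    intro l hl
    have hne : l ≠ [] := by rintro rfl; simp at hl
    rw [subdivide_single (by simpa using hne), subdivide_single hne, antipode_cone,
      barycenter_map_neg, listBdry_map_neg]
    congr 1
    refine map_eq (subdivide ∘ₗ antipode (X := E)) (antipode ∘ₗ subdivide (E := E))
      (fun m hm => ?_) (listBdry_mem l)
    rw [LinearMap.comp_apply, LinearMap.comp_apply, antipode_single]
    exact ih m (by omega)

theorem subdivide_antipode (c : ListChain E) :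
    subdivide (antipode c) = antipode (subdivide c) := by
  have h : subdivide ∘ₗ antipode = antipode ∘ₗ (subdivide (E := E)) := by
    ext1 l; ext1
    simpa using subdivide_single_map_neg _ l rfl
  exact congrArg (· c) h

theorem barycenter_mem_convexHull {l : List E} (hl : l ≠ []) :
    barycenter l ∈ convexHull ℝ {x | x ∈ l} := by
  have h0 : (l.length : ℝ) ≠ 0 := by simpa using hl
  have : barycenter l = ∑ i : Fin l.length, (l.length : ℝ)⁻¹ • l.get i := by
    rw [← Finset.smul_sum, barycenter]
    simp
  rw [this]
  refine (convex_convexHull ℝ _).sum_mem (fun i _ => by positivity) (by simp [h0]) ?_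
  intro i _
  exact subset_convexHull _ _ (by simp)

theorem dist_barycenter_le {l : List E} {D : ℝ}
    (hD : ∀ x ∈ l, ∀ y ∈ l, dist x y ≤ D) {y : E} (hy : y ∈ convexHull ℝ {x | x ∈ l}) :
    dist y (barycenter l) ≤ (1 - (l.length : ℝ)⁻¹) * D := by
  suffices h : {x | x ∈ l} ⊆ Metric.closedBall (barycenter l) ((1 - (l.length : ℝ)⁻¹) * D) from
    convexHull_min h (convex_closedBall _ _) hy
  intro v hv
  obtain ⟨i, rfl⟩ := List.get_of_mem hv
  have hpos : 0 < l.length := i.pos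
  have h0 : (l.length : ℝ) ≠ 0 := by positivity
  have e1 : l.get i - barycenter l =
      (l.length : ℝ)⁻¹ • ∑ j ∈ Finset.univ.erase i, (l.get i - l.get j) := by
    have : ∑ j ∈ Finset.univ.erase i, (l.get i - l.get j) = ∑ j, (l.get i - l.get j) := by
      rw [← Finset.add_sum_erase _ _ (Finset.mem_univ i)]; simp
    rw [this, Finset.sum_sub_distrib, smul_sub, barycenter]
    simp only [Finset.sum_const, Finset.card_univ, Fintype.card_fin]
    rw [← Nat.cast_smul_eq_nsmul ℝ, smul_smul, inv_mul_cancel₀ h0, one_smul]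
    simp
  rw [Metric.mem_closedBall, dist_eq_norm, e1, norm_smul]
  have e2 : ‖∑ j ∈ Finset.univ.erase i, (l.get i - l.get j)‖ ≤ (l.length - 1) * D := by
    refine (norm_sum_le_of_le _ (n := fun _ => D) ?_).trans ?_
    · intro j _
      rw [← dist_eq_norm]
      exact hD _ (l.get_mem i) _ (l.get_mem j)
    · simp [Finset.card_erase_of_mem, Nat.cast_sub (Nat.succ_le_of_lt hpos)]
  calc ‖(l.length : ℝ)⁻¹‖ * _ ≤ (l.length : ℝ)⁻¹ * ((l.length - 1) * D) := by
        rw [Real.norm_of_nonneg (by positivity)]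
        gcongr
    _ = _ := by field_simp

/-- Subdivision shrinks a simplex with `n` vertices by the factor `1 - 1 / n`. -/
theorem subdivide_single_mem (n : ℕ) : ∀ (l : List E) (D : ℝ), l.length = n → 0 ≤ D →
    (∀ x ∈ l, ∀ y ∈ l, dist x y ≤ D) → subdivide (Finsupp.single l 1) ∈ SupportedOn (fun m =>
      m.length = n ∧ (∀ x ∈ m, x ∈ convexHull ℝ {y | y ∈ l}) ∧
        ∀ x ∈ m, ∀ y ∈ m, dist x y ≤ (1 - (n : ℝ)⁻¹) * D) := by
  induction n with
  | zero =>
    intro l D hl _ _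
    obtain rfl := List.eq_nil_of_length_eq_zero hl
    rw [subdivide_nil]
    exact single_mem (by simp)
  | succ n ih =>
    intro l D hl hD0 hD
    have hne : l ≠ [] := by rintro rfl; simp at hl
    rw [subdivide_single hne]
    have h1 : subdivide (listBdry l) ∈ SupportedOn (fun m =>
        m.length = n ∧ (∀ x ∈ m, x ∈ convexHull ℝ {y | y ∈ l}) ∧
        ∀ x ∈ m, ∀ y ∈ m, dist x y ≤ (1 - (n : ℝ)⁻¹) * D) := by
      refine map_mem _ _ ?_ (listBdry_mem l)
      rintro m ⟨hm, hml⟩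
      refine supportedOn_mono ?_ (ih m D (by omega) hD0
        (fun x hx y hy => hD x (hml hx) y (hml hy)))
      rintro m' ⟨h1, h2, h3⟩
      exact ⟨h1, fun x hx => convexHull_mono (fun y hy => hml hy) (h2 x hx), h3⟩
    refine map_mem _ _ ?_ h1
    rintro m ⟨hm1, hm2, hm3⟩
    rw [cone_single]
    have hb := barycenter_mem_convexHull hne
    have hfac : (1 - (n : ℝ)⁻¹) * D ≤ (1 - ((n + 1 : ℕ) : ℝ)⁻¹) * D ∨ m = [] := by
      rcases Nat.eq_zero_or_pos n with rfl | hn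
      · exact Or.inr (List.eq_nil_of_length_eq_zero hm1)
      · left
        push_cast
        gcongr
        linarith
    have hd : ∀ y ∈ convexHull ℝ {x | x ∈ l},
        dist y (barycenter l) ≤ (1 - ((n + 1 : ℕ) : ℝ)⁻¹) * D := by
      intro y hy
      simpa [hl] using dist_barycenter_le hD hy
    refine single_mem ⟨by simp [hm1], ?_, ?_⟩
    · intro x hx
      rcases List.mem_cons.1 hx with rfl | hx
      · exact hb
      · exact hm2 x hx
    · intro x hx y hy
      rcases List.mem_cons.1 hx with rfl | hx <;> rcases List.mem_cons.1 hy with rfl | hy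
      · exact hd _ hb
      · rw [dist_comm]; exact hd _ (hm2 y hy)
      · exact hd _ (hm2 x hx)
      · rcases hfac with h | rfl
        · exact (hm3 x hx y hy).trans h
        · simp at hx

end ListChain

namespace ListChain

/-! ### Subdivided cross-polytopes and the Borsuk–Ulam theorem -/

section Iterate

variable {E : Type*} [NormedAddCommGroup E] [NormedSpace ℝ E]

theorem bdry_subdivide_iterate (N : ℕ) (c : ListChain E) :
    bdry (subdivide^[N] c) = subdivide^[N] (bdry c) :=
  Function.Commute.iterate_right (f := bdry) (g := subdivide)
    (fun c => bdry_subdivide c) N c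

theorem subdivide_iterate_antipode (N : ℕ) (c : ListChain E) :
    subdivide^[N] (antipode c) = antipode (subdivide^[N] c) :=
  (Function.Commute.iterate_right (f := antipode) (g := subdivide)
    (fun c => (subdivide_antipode c).symm) N c).symm

theorem subdivide_iterate_add (N : ℕ) (c d : ListChain E) :
    subdivide^[N] (c + d) = subdivide^[N] c + subdivide^[N] d := by
  rw [← Module.End.coe_pow, map_add]

/-- Iterated subdivision stays in any family of convex sets that contain the simplices of a chain,
and its mesh tends to zero geometrically. -/
theorem subdivide_iterate_mem {ι : Type*} {S : ι → Set E} (hS : ∀ i, Convex ℝ (S i)) {n : ℕ}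
    {D : ℝ} (hD : 0 ≤ D) {c : ListChain E}
    (hc : c ∈ SupportedOn (fun m => m.length = n + 1 ∧ (∃ i, ∀ x ∈ m, x ∈ S i) ∧
      ∀ x ∈ m, ∀ y ∈ m, dist x y ≤ D)) (N : ℕ) :
    subdivide^[N] c ∈ SupportedOn (fun m => m.length = n + 1 ∧ (∃ i, ∀ x ∈ m, x ∈ S i) ∧
      ∀ x ∈ m, ∀ y ∈ m, dist x y ≤ (1 - ((n + 1 : ℕ) : ℝ)⁻¹) ^ N * D) := by
  have h0 : 0 ≤ 1 - ((n + 1 : ℕ) : ℝ)⁻¹ := by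
    rw [sub_nonneg]
    exact inv_le_one_of_one_le₀ (by norm_num)
  induction N with
  | zero => simpa using hc
  | succ N ih =>
    rw [Function.iterate_succ_apply']
    refine map_mem _ _ ?_ ih
    rintro m ⟨h1, ⟨i, h2⟩, h3⟩
    refine supportedOn_mono ?_ (subdivide_single_mem (n + 1) m _ h1 (by positivity) h3)
    rintro m' ⟨h1', h2', h3'⟩
    refine ⟨h1', ⟨i, fun x hx => ?_⟩, ?_⟩
    · exact convexHull_min (fun y hy => h2 y hy) (hS i) (h2' x hx)
    · intro x hx y hy
      refine (h3' x hx y hy).trans (le_of_eq ?_)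
      rw [pow_succ]; ring

end Iterate

/-- The vertices of a cross-polytope of radius `k` in `ℝ^k`, followed by the origin. -/
def crossVertex (k i : ℕ) : Fin k → ℝ := fun j => if (j : ℕ) = i then (k : ℝ) else 0

/-- The boundary of the cross-polytope spanned by the first `i` coordinate axes. -/
def crossPolytope (k : ℕ) : ℕ → ListChain (Fin k → ℝ)
  | 0 => Finsupp.single [] 1
  | i + 1 => cone (crossVertex k i) (crossPolytope k i) +
      cone (-crossVertex k i) (crossPolytope k i)

/-- A hemisphere of the next cross-polytope; for `i = k`, where the apex is the origin, the solid
cross-polytope. -/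
def hemisphere (k i : ℕ) : ListChain (Fin k → ℝ) := cone (crossVertex k i) (crossPolytope k i)

theorem bdry_crossPolytope (k i : ℕ) : bdry (crossPolytope k i) = 0 := by
  induction i with
  | zero => simp [crossPolytope, listBdry]
  | succ i ih => simp [crossPolytope, bdry_cone, ih, ZModModule.add_self]

theorem bdry_hemisphere (k i : ℕ) : bdry (hemisphere k i) = crossPolytope k i := by
  simp [hemisphere, bdry_cone, bdry_crossPolytope]

theorem antipode_crossPolytope (k i : ℕ) : antipode (crossPolytope k i) = crossPolytope k i := by
  induction i with
  | zero => simp [crossPolytope]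
  | succ i ih => simp [crossPolytope, antipode_cone, ih, add_comm]

theorem crossPolytope_succ (k i : ℕ) :
    crossPolytope k (i + 1) = hemisphere k i + antipode (hemisphere k i) := by
  simp [hemisphere, antipode_cone, antipode_crossPolytope, crossPolytope]

theorem norm_crossVertex_le (k i : ℕ) : ‖crossVertex k i‖ ≤ k := by
  rw [pi_norm_le_iff_of_nonneg (by positivity)]
  intro j
  simp only [crossVertex]
  split_ifs <;> simp

/-- The tuple `m` has `i` entries, in the span of the first `i` coordinate vectors, and lies in a
facet hyperplane `∑ ± x j = k` of the cross-polytope. -/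
def InFacet (k i : ℕ) (m : List (Fin k → ℝ)) : Prop :=
  m.length = i ∧ (∀ x ∈ m, ‖x‖ ≤ k) ∧ (∀ x ∈ m, ∀ j : Fin k, i ≤ j → x j = 0) ∧
    ∃ ε : Fin k → ℝ, (∀ j, |ε j| ≤ 1) ∧ ∀ x ∈ m, ∑ j, ε j * x j = k

theorem cone_smul_crossVertex_mem {k i : ℕ} (hi : i < k) {σ : ℝ} (hσ : |σ| = 1)
    {c : ListChain (Fin k → ℝ)} (hc : c ∈ SupportedOn (InFacet k i)) :
    cone (σ • crossVertex k i) c ∈ SupportedOn (InFacet k (i + 1)) := by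
  refine map_mem _ _ ?_ hc
  rintro m ⟨h1, h2, h3, ε, h4, h5⟩
  rw [cone_single]
  refine single_mem ⟨by simp [h1], ?_, ?_, Function.update ε ⟨i, hi⟩ σ, ?_, ?_⟩
  · intro x hx
    rcases List.mem_cons.1 hx with rfl | hx
    · rw [norm_smul, Real.norm_eq_abs, hσ, one_mul]
      exact norm_crossVertex_le k i
    · exact h2 x hx
  · intro x hx j hj
    rcases List.mem_cons.1 hx with rfl | hx
    · have : (j : ℕ) ≠ i := by omega
      simp [crossVertex, this]
    · exact h3 x hx j (by omega)
  · intro j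
    rcases eq_or_ne j ⟨i, hi⟩ with rfl | hj
    · simp [hσ]
    · simp [hj, h4]
  · intro x hx
    rcases List.mem_cons.1 hx with rfl | hx
    · rw [Finset.sum_eq_single (⟨i, hi⟩ : Fin k)]
      · have : σ * σ = 1 := by rw [← abs_mul_abs_self, hσ, one_mul]
        simp [crossVertex, ← mul_assoc, this]
      · intro j _ hj
        have : (j : ℕ) ≠ i := fun h => hj (Fin.ext h)
        simp [crossVertex, this]
      · simp
    · rw [← h5 x hx]
      refine Finset.sum_congr rfl fun j _ => ?_
      rcases eq_or_ne j ⟨i, hi⟩ with rfl | hj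
      · simp [h3 x hx]
      · simp [hj]

theorem crossPolytope_mem (k i : ℕ) (hi : i ≤ k) :
    crossPolytope k i ∈ SupportedOn (InFacet k i) := by
  induction i with
  | zero => exact single_mem ⟨rfl, by simp, by simp, 0, by simp, by simp⟩
  | succ i ih =>
    have h1 := cone_smul_crossVertex_mem (σ := 1) hi (by simp) (ih (by omega))
    have h2 := cone_smul_crossVertex_mem (σ := -1) hi (by simp) (ih (by omega))
    rw [one_smul] at h1
    rw [neg_one_smul] at h2
    exact Submodule.add_mem _ h1 h2

theorem dist_le_two_mul_of_norm_le {E : Type*} [SeminormedAddCommGroup E] {x y : E} {r : ℝ}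
    (hx : ‖x‖ ≤ r) (hy : ‖y‖ ≤ r) : dist x y ≤ 2 * r := by
  rw [dist_eq_norm]
  linarith [norm_sub_le x y]

/-- The simplices of a subdivided hemisphere stay outside the open unit ball for the sup norm, as
each of them lies in a hyperplane `∑ ± x j = k`. -/
theorem subdivide_hemisphere_mem {k i : ℕ} (hi : i < k) (N : ℕ) :
    subdivide^[N] (hemisphere k i) ∈
      SupportedOn (fun m => m.length = i + 1 ∧ ∀ x ∈ m, 1 ≤ ‖x‖) := by
  let S : {ε : Fin k → ℝ // ∀ j, |ε j| ≤ 1} → Set (Fin k → ℝ) :=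
    fun ε => {x | ∑ j, ε.1 j * x j = k}
  have hS : ∀ ε, Convex ℝ (S ε) := by
    intro ε x hx y hy a b _ _ hab
    change ∑ j, ε.1 j * (a * x j + b * y j) = k
    have : ∑ j, ε.1 j * (a * x j + b * y j) =
        a * ∑ j, ε.1 j * x j + b * ∑ j, ε.1 j * y j := by
      rw [Finset.mul_sum, Finset.mul_sum, ← Finset.sum_add_distrib]
      exact Finset.sum_congr rfl fun j _ => by ring
    rw [this, show ∑ j, ε.1 j * x j = k from hx, show ∑ j, ε.1 j * y j = k from hy, ← add_mul,
      hab, one_mul]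
  have h0 : hemisphere k i ∈ SupportedOn (fun m => m.length = i + 1 ∧
      (∃ ε, ∀ x ∈ m, x ∈ S ε) ∧ ∀ x ∈ m, ∀ y ∈ m, dist x y ≤ 2 * (k : ℝ)) := by
    have h := cone_smul_crossVertex_mem (σ := 1) hi (by simp) (crossPolytope_mem k i hi.le)
    rw [one_smul] at h
    refine supportedOn_mono ?_ h
    rintro m ⟨h1, h2, -, ε, h4, h5⟩
    exact ⟨h1, ⟨⟨ε, h4⟩, h5⟩, fun x hx y hy => dist_le_two_mul_of_norm_le (h2 x hx) (h2 y hy)⟩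
  refine supportedOn_mono ?_ (subdivide_iterate_mem hS (by positivity) h0 N)
  rintro m ⟨h1, ⟨⟨ε, hε⟩, h2⟩, -⟩
  refine ⟨h1, fun x hx => ?_⟩
  have hk : (0 : ℝ) < k := by exact_mod_cast Nat.zero_lt_of_lt hi
  have h3 : (k : ℝ) ≤ k * ‖x‖ := by
    calc (k : ℝ) = ∑ j, ε j * x j := (h2 x hx).symm
      _ ≤ ∑ _j : Fin k, ‖x‖ := by
        refine Finset.sum_le_sum fun j _ => ?_
        calc ε j * x j ≤ |ε j| * |x j| := by rw [← abs_mul]; exact le_abs_self _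
          _ ≤ 1 * ‖x‖ := mul_le_mul (hε j) (norm_le_pi_norm x j) (abs_nonneg _) zero_le_one
          _ = ‖x‖ := one_mul _
      _ = k * ‖x‖ := by simp
  exact le_of_mul_le_mul_left (by linarith) hk

theorem subdivide_solid_mem (k N : ℕ) :
    subdivide^[N] (hemisphere k k) ∈ SupportedOn (fun m => m.length = k + 1 ∧
      (∀ x ∈ m, x ∈ Metric.closedBall 0 (k : ℝ)) ∧
      ∀ x ∈ m, ∀ y ∈ m, dist x y ≤ (1 - ((k + 1 : ℕ) : ℝ)⁻¹) ^ N * (2 * (k : ℝ))) := by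
  have h0 : hemisphere k k ∈ SupportedOn (fun m => m.length = k + 1 ∧
      (∃ _ : Unit, ∀ x ∈ m, x ∈ Metric.closedBall (0 : Fin k → ℝ) (k : ℝ)) ∧
        ∀ x ∈ m, ∀ y ∈ m, dist x y ≤ 2 * (k : ℝ)) := by
    refine map_mem _ _ ?_ (crossPolytope_mem k k le_rfl)
    rintro m ⟨h1, h2, -, -⟩
    rw [cone_single]
    have h3 : ∀ x ∈ crossVertex k k :: m, ‖x‖ ≤ k := by
      intro x hx
      rcases List.mem_cons.1 hx with rfl | hx
      · exact norm_crossVertex_le k k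
      · exact h2 x hx
    exact single_mem ⟨by simp [h1], ⟨(), fun x hx => by simpa using h3 x hx⟩,
      fun x hx y hy => dist_le_two_mul_of_norm_le (h3 x hx) (h3 y hy)⟩
  refine supportedOn_mono ?_
    (subdivide_iterate_mem (fun _ : Unit => convex_closedBall _ _) (by positivity) h0 N)
  rintro m ⟨h1, ⟨-, h2⟩, h3⟩
  exact ⟨h1, h2, h3⟩

/-- If the functions `s n` change by one under the antipodal map on the sphere, their cup product
detects every hemisphere. -/
theorem eval_cupProduct_hemisphere {k : ℕ} {s : ℕ → (Fin k → ℝ) → ZMod 2}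
    (hs : ∀ n x, 1 ≤ ‖x‖ → s n (-x) = s n x + 1) (N : ℕ) {i : ℕ} (hi : i ≤ k) :
    eval (cupProduct s) (subdivide^[N] (hemisphere k i)) = 1 := by
  induction i with
  | zero =>
    have : subdivide^[N] (hemisphere k 0) = Finsupp.single [crossVertex k 0] 1 := by
      induction N with
      | zero => simp [hemisphere, crossPolytope]
      | succ N ih =>
        rw [Function.iterate_succ_apply', ih, subdivide_single (by simp)]
        simp [listBdry, subdivide_nil, barycenter]
    simp [this, cupProduct]
  | succ i ih =>
    have hlen : subdivide^[N] (hemisphere k (i + 1)) ∈ SupportedOn (fun m => m.length = i + 2) := by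
      rcases hi.lt_or_eq with h | rfl
      · exact supportedOn_mono (fun m hm => hm.1) (subdivide_hemisphere_mem h N)
      · exact supportedOn_mono (fun m hm => hm.1) (subdivide_solid_mem _ N)
    have h1 : eval (cupProduct s) (subdivide^[N] (hemisphere k (i + 1))) =
        eval (primitive s) (bdry (subdivide^[N] (hemisphere k (i + 1)))) := by
      refine map_eq (eval (cupProduct s)) (eval (primitive s) ∘ₗ bdry (X := Fin k → ℝ))
        (fun m hm => ?_) hlen
      rw [LinearMap.comp_apply, bdry_single, eval_primitive_listBdry s m (by omega)]
      simp
    rw [h1, bdry_subdivide_iterate, bdry_hemisphere, crossPolytope_succ, subdivide_iterate_add,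
      subdivide_iterate_antipode, map_add, ← ih (by omega)]
    refine map_eq (eval (primitive s) + eval (primitive s) ∘ₗ antipode (X := Fin k → ℝ))
        (eval (cupProduct s)) (fun m hm => ?_) (subdivide_hemisphere_mem hi N)
    rw [LinearMap.add_apply, LinearMap.comp_apply, antipode_single]
    simp only [Finsupp.linearCombination_single, one_smul]
    exact primitive_add_primitive_neg hm.1.le fun n _ x hx => hs n x (hm.2 x hx)

theorem exists_ne_of_cupProduct_ne_zero {X : Type*} {s : ℕ → X → ZMod 2} {l : List X}
    (hl : cupProduct s l ≠ 0) {n : ℕ} (h1 : 1 ≤ n) (hn : n < l.length) :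
    ∃ x ∈ l, ∃ y ∈ l, s n x ≠ s n y := by
  induction l with
  | nil => simp at hn
  | cons x l ih =>
    match l, ih, hl, hn with
    | [], _, _, hn => simp only [List.length_cons, List.length_nil] at hn; omega
    | y :: l, ih, hl, hn =>
      rw [cupProduct] at hl
      rcases Nat.lt_or_ge n (y :: l).length with h | h
      · obtain ⟨a, ha, b, hb, hab⟩ := ih (right_ne_zero_of_mul hl) h
        exact ⟨a, List.mem_cons_of_mem _ ha, b, List.mem_cons_of_mem _ hb, hab⟩
      · obtain rfl : n = l.length + 1 := by
          simp only [List.length_cons] at hn h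
          omega
        refine ⟨x, by simp, y, by simp, fun h => left_ne_zero_of_mul hl ?_⟩
        rw [h, ZModModule.add_self]

end ListChain

open ListChain Classical in
/-- **Borsuk–Ulam theorem** for a ball: a self-map of `ℝ^k` that is odd outside the open unit ball
has a zero. -/
theorem exists_eq_zero_of_odd {k : ℕ} {f : (Fin k → ℝ) → Fin k → ℝ} (hf : Continuous f)
    (hodd : ∀ x, 1 ≤ ‖x‖ → f (-x) = -f x) : ∃ x, f x = 0 := by
  by_contra! hne
  -- signs of the coordinates of `f`, with an arbitrary odd choice where a coordinate vanishes
  let g : ℕ → (Fin k → ℝ) → ℝ := fun n x => if h : n - 1 < k then f x ⟨n - 1, h⟩ else 0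
  let s : ℕ → (Fin k → ℝ) → ZMod 2 := fun n x =>
    if 0 < g n x then 1 else if g n x < 0 then 0 else if WellOrderingRel x (-x) then 1 else 0
  have hs : ∀ n x, 1 ≤ ‖x‖ → s n (-x) = s n x + 1 := by
    intro n x hx
    have hg : g n (-x) = -g n x := by
      simp only [g]
      split_ifs
      · rw [hodd x hx]; rfl
      · simp
    simp only [s, hg, neg_neg, Left.neg_pos_iff, Left.neg_neg_iff]
    have htwo : (0 : ZMod 2) = 1 + 1 := by decide
    rcases lt_trichotomy (g n x) 0 with h | h | h
    · simp [h, not_lt.2 h.le]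
    · have hx0 : x ≠ -x := by
        intro h
        have : x = 0 := self_eq_neg.1 h
        rw [this, norm_zero] at hx
        linarith
      rcases trichotomous_of WellOrderingRel x (-x) with h' | h' | h'
      · have := asymm_of WellOrderingRel h'
        simp [h, h', this, htwo]
      · exact absurd h' hx0
      · have := asymm_of WellOrderingRel h'
        simp [h, h', this]
    · simp [h, not_lt.2 h.le, htwo]
  have hcpt := isCompact_closedBall (0 : Fin k → ℝ) (k : ℝ)
  obtain ⟨ε, hε, hεf⟩ : ∃ ε > 0, ∀ x ∈ Metric.closedBall (0 : Fin k → ℝ) (k : ℝ), ε ≤ ‖f x‖ := by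
    obtain ⟨x0, -, hx0⟩ := hcpt.exists_isMinOn ⟨0, by simp⟩ hf.norm.continuousOn
    exact ⟨‖f x0‖, norm_pos_iff.2 (hne x0), fun x hx => hx0 hx⟩
  obtain ⟨η, hη, hηf⟩ := Metric.uniformContinuousOn_iff.1
    (hcpt.uniformContinuousOn_of_continuous hf.continuousOn) ε hε
  obtain ⟨N, hN⟩ : ∃ N : ℕ, (1 - ((k + 1 : ℕ) : ℝ)⁻¹) ^ N * (2 * (k : ℝ)) < η := by
    have h0 : 0 ≤ 1 - ((k + 1 : ℕ) : ℝ)⁻¹ := by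
      rw [sub_nonneg]
      exact inv_le_one_of_one_le₀ (by norm_num)
    have h1 : 1 - ((k + 1 : ℕ) : ℝ)⁻¹ < 1 := by
      rw [sub_lt_self_iff]; positivity
    have := (tendsto_pow_atTop_nhds_zero_of_lt_one h0 h1).mul_const (2 * (k : ℝ))
    rw [zero_mul] at this
    exact (this.eventually_lt_const hη).exists
  have hzero : eval (cupProduct s) (subdivide^[N] (hemisphere k k)) = 0 := by
    refine map_eq (eval (cupProduct s)) 0 (fun m hm => ?_) (subdivide_solid_mem k N)
    obtain ⟨hlen, hball, hdist⟩ := hm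
    simp only [Finsupp.linearCombination_single, one_smul, LinearMap.zero_apply]
    by_contra hcup
    obtain ⟨z, l, rfl⟩ := List.exists_cons_of_length_eq_add_one hlen
    -- every coordinate changes its sign on the small tuple, so `f` is small at its first vertex
    have hlt : ‖f z‖ < ε := by
      rw [pi_norm_lt_iff hε]
      intro j
      obtain ⟨x, hx, y, hy, hxy⟩ := exists_ne_of_cupProduct_ne_zero hcup (n := j + 1) (by omega)
        (by rw [hlen]; omega)
      have hgj : ∀ w, g (j + 1) w = f w j := fun w => by simp [g]
      have hz : z ∈ z :: l := by simp
      have hclose : ∀ w ∈ z :: l, |f z j - f w j| < ε := by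
        intro w hw
        have := hηf z (hball z hz) w (hball w hw) ((hdist z hz w hw).trans_lt hN)
        rw [dist_eq_norm] at this
        exact (norm_le_pi_norm (f z - f w) j).trans_lt this
      have hx' := abs_lt.1 (hclose x hx)
      have hy' := abs_lt.1 (hclose y hy)
      rw [Real.norm_eq_abs, abs_lt]
      by_contra hbig
      apply hxy
      simp only [s, hgj]
      rcases le_or_gt ε (f z j) with h | h
      · rw [if_pos (by linarith), if_pos (by linarith)]
      · have h' : f z j ≤ -ε := by
          by_contra h''
          exact hbig ⟨by linarith, h⟩
        rw [if_neg (by linarith), if_pos (by linarith), if_neg (by linarith), if_pos (by linarith)]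
    exact absurd (hεf z (hball z (by simp))) (not_le.2 hlt)
  rw [eval_cupProduct_hemisphere hs N le_rfl] at hzero
  exact one_ne_zero hzero

/-! ### Barycentric coordinates -/

/-- Formal convex combinations of vertices: the coordinates are non-negative and sum to one. -/
structure IsBarycentric {V : Type*} (p : V →₀ ℝ) : Prop where
  nonneg : ∀ v, 0 ≤ p v
  sum_eq : (p.sum fun _ a => a) = 1

namespace IsBarycentric

variable {V : Type*} {p q : V →₀ ℝ}

theorem sum_of_subset (hp : IsBarycentric p) {F : Finset V} (hF : p.support ⊆ F) :
    ∑ v ∈ F, p v = 1 := by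
  rw [← hp.sum_eq, Finsupp.sum_of_support_subset _ hF _ (by simp)]

theorem support_nonempty (hp : IsBarycentric p) : p.support.Nonempty := by
  rw [Finset.nonempty_iff_ne_empty]
  intro h
  have := hp.sum_of_subset h.le
  simp at this

theorem mem_support_iff (hp : IsBarycentric p) {v : V} : v ∈ p.support ↔ 0 < p v := by
  rw [Finsupp.mem_support_iff, (hp.nonneg v).lt_iff_ne, ne_comm]

theorem combination (hp : IsBarycentric p) (hq : IsBarycentric q) {a b : ℝ} (ha : 0 ≤ a)
    (hb : 0 ≤ b) (hab : a + b = 1) : IsBarycentric (a • p + b • q) := by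
  classical
  refine ⟨fun v => ?_, ?_⟩
  · have := hp.nonneg v
    have := hq.nonneg v
    simp only [Finsupp.add_apply, Finsupp.smul_apply, smul_eq_mul]
    positivity
  · have hsub : (a • p + b • q).support ⊆ p.support ∪ q.support :=
      Finsupp.support_add.trans
        (Finset.union_subset_union Finsupp.support_smul Finsupp.support_smul)
    rw [Finsupp.sum_of_support_subset _ hsub _ (by simp)]
    simp only [Finsupp.add_apply, Finsupp.smul_apply, smul_eq_mul, Finset.sum_add_distrib,
      ← Finset.mul_sum]
    rw [hp.sum_of_subset Finset.subset_union_left, hq.sum_of_subset Finset.subset_union_right]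
    simpa using hab

theorem single (v : V) : IsBarycentric (Finsupp.single v (1 : ℝ)) := by
  classical
  refine ⟨fun w => ?_, by simp⟩
  rw [Finsupp.single_apply]
  split_ifs <;> norm_num

end IsBarycentric

theorem mem_support_combination {V : Type*} {p q : V →₀ ℝ} {a b : ℝ} {v : V}
    (h : v ∈ (a • p + b • q).support) : a ≠ 0 ∧ v ∈ p.support ∨ b ≠ 0 ∧ v ∈ q.support := by
  simp only [Finsupp.mem_support_iff, Finsupp.add_apply, Finsupp.smul_apply, smul_eq_mul] at h ⊢
  by_contra! hcon
  apply h
  rcases eq_or_ne a 0 with rfl | ha <;> rcases eq_or_ne b 0 with rfl | hb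
  · simp
  · simp [hcon.2 hb]
  · simp [hcon.1 ha]
  · simp [hcon.1 ha, hcon.2 hb]

/-- The average of the vertices `z i`, `i ∈ s`, with weights proportional to `w i`. -/
def vertexAverage {ι V : Type*} (s : Finset ι) (w : ι → ℝ) (z : ι → V) : V →₀ ℝ :=
  ∑ i ∈ s, Finsupp.single (z i) (w i / ∑ j ∈ s, w j)

section vertexAverage

variable {ι V : Type*} {s : Finset ι} {w : ι → ℝ} {z : ι → V}

theorem isBarycentric_vertexAverage (hw : ∀ i ∈ s, 0 ≤ w i) (hpos : ∃ i ∈ s, 0 < w i) :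
    IsBarycentric (vertexAverage s w z) := by
  classical
  have h0 : 0 < ∑ j ∈ s, w j := Finset.sum_pos' hw hpos
  refine ⟨fun v => ?_, ?_⟩
  · rw [vertexAverage, Finsupp.finsetSum_apply]
    refine Finset.sum_nonneg fun i hi => ?_
    rw [Finsupp.single_apply]
    split_ifs
    · exact div_nonneg (hw i hi) h0.le
    · exact le_rfl
  · rw [vertexAverage, ← Finsupp.sum_finsetSum_index (by simp) (by simp)]
    simp only [Finsupp.sum_single_index]
    rw [← Finset.sum_div, div_self h0.ne']

theorem exists_of_mem_support_vertexAverage {v : V} (hv : v ∈ (vertexAverage s w z).support) :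
    ∃ i ∈ s, w i ≠ 0 ∧ z i = v := by
  classical
  obtain ⟨i, hi, h⟩ := Finsupp.mem_support_finsetSum _ hv
  refine ⟨i, hi, ?_⟩
  rw [Finsupp.mem_support_iff, Finsupp.single_apply] at h
  split_ifs at h with h'
  · exact ⟨fun h0 => h (by simp [h0]), h'⟩
  · exact absurd rfl h

theorem support_vertexAverage_subset [DecidableEq V] :
    (vertexAverage s w z).support ⊆ s.image z := by
  intro v hv
  obtain ⟨i, hi, -, rfl⟩ := exists_of_mem_support_vertexAverage hv
  exact Finset.mem_image_of_mem _ hi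

theorem continuous_vertexAverage_apply {X : Type*} [TopologicalSpace X] {w : X → ι → ℝ}
    (hw : ∀ i ∈ s, Continuous fun x => w x i) (h0 : ∀ x, ∑ i ∈ s, w x i ≠ 0) (v : V) :
    Continuous fun x => vertexAverage s (w x) z v := by
  classical
  simp only [vertexAverage, Finsupp.finsetSum_apply, Finsupp.single_apply]
  refine continuous_finsetSum _ fun i hi => ?_
  split_ifs
  · exact (hw i hi).div (continuous_finsetSum _ hw) h0
  · exact continuous_const

end vertexAverage

/-! ### The weak topology of a realization -/

namespace Realization

variable {V : Type*} {K : PreAbstractSimplicialComplex V}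

theorem isBarycentric (p : Realization K) : IsBarycentric p.coord := ⟨p.2.1, p.2.2.1⟩

theorem support_mem (p : Realization K) : p.coord.support ∈ K := p.2.2.2

/-- The point with given barycentric coordinates. -/
def ofCoord (p : V →₀ ℝ) (hp : IsBarycentric p) (hK : p.support ∈ K) : Realization K :=
  ⟨p, hp.nonneg, hp.sum_eq, hK⟩

@[simp] theorem coord_ofCoord (p : V →₀ ℝ) (hp : IsBarycentric p) (hK : p.support ∈ K) :
    (ofCoord p hp hK : Realization K).coord = p := rfl

theorem ext_coord {p q : Realization K} (h : p.coord = q.coord) : p = q := Subtype.ext h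

theorem continuous_coord_closedSimplex (σ : Finset V) (v : V) :
    Continuous fun p : ClosedSimplex K σ => (Subtype.val p).coord v :=
  (continuous_apply v).comp continuous_induced_dom

theorem continuous_iff {Y : Type*} [TopologicalSpace Y] {g : Realization K → Y} :
    Continuous g ↔
      ∀ σ : K.faces, Continuous fun p : ClosedSimplex K σ.1 => g (Subtype.val p) := by
  rw [continuous_iSup_dom]
  exact forall_congr' fun σ => continuous_coinduced_dom

theorem continuous_closedSimplex_val {σ : Finset V} (hσ : σ ∈ K) :
    Continuous fun p : ClosedSimplex K σ => (Subtype.val p : Realization K) :=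
  continuous_iff.1 continuous_id ⟨σ, hσ⟩

theorem continuous_coord (v : V) : Continuous fun p : Realization K => p.coord v :=
  continuous_iff.2 fun _ => continuous_coord_closedSimplex _ v

/-- Linear functionals of the barycentric coordinates are continuous, even those with unbounded
coefficients. -/
theorem continuous_linear (a : V → ℝ) :
    Continuous fun p : Realization K => p.coord.sum fun v c => c * a v := by
  refine continuous_iff.2 fun σ => ?_
  have : (fun p : ClosedSimplex K σ.1 => (Subtype.val p).coord.sum fun v c => c * a v) =
      fun p => ∑ v ∈ σ.1, (Subtype.val p).coord v * a v := by
    funext p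
    exact Finsupp.sum_of_support_subset _ p.2 _ (by simp)
  rw [this]
  exact continuous_finsetSum _ fun v _ =>
    (continuous_coord_closedSimplex _ v).mul continuous_const

/-- A compact family of points uses finitely many vertices: otherwise a linear functional with
large coefficients is unbounded on it. -/
theorem exists_finset_support_subset {X : Type*} [TopologicalSpace X] [CompactSpace X]
    {f : X → Realization K} (hf : Continuous f) :
    ∃ F : Finset V, ∀ x, (f x).coord.support ⊆ F := by
  classical
  let W : Set V := {v | ∃ x, v ∈ (f x).coord.support}
  by_cases hW : W.Finite
  · exact ⟨hW.toFinset, fun x v hv => hW.mem_toFinset.2 ⟨x, hv⟩⟩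
  exfalso
  have : Infinite W := Set.infinite_coe_iff.2 hW
  let e := Infinite.natEmbedding W
  choose x hx using fun j => (e j).2
  have hpos : ∀ j, 0 < (f (x j)).coord (e j) := fun j =>
    (f (x j)).isBarycentric.mem_support_iff.1 (hx j)
  have hinj : Function.Injective fun j => (e j : V) := Subtype.val_injective.comp e.injective
  let a : V → ℝ := Function.extend (fun j => (e j : V))
    (fun j => (j : ℝ) / (f (x j)).coord (e j)) 0
  have ha : ∀ v, 0 ≤ a v := by
    intro v
    by_cases h : ∃ j, (e j : V) = v
    · obtain ⟨j, rfl⟩ := h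
      simp only [a, hinj.extend_apply]
      have := hpos j
      positivity
    · simp [a, Function.extend_apply' _ _ _ h]
  have hc := (continuous_linear (K := K) a).comp hf
  obtain ⟨M, hM⟩ := (isCompact_range hc).bddAbove
  obtain ⟨j, hj⟩ := exists_nat_gt M
  have h1 : (f (x j)).coord.sum (fun v c => c * a v) ≤ M := hM ⟨x j, rfl⟩
  have h2 : (f (x j)).coord (e j) * a (e j) ≤ (f (x j)).coord.sum (fun v c => c * a v) :=
    Finset.single_le_sum (f := fun v => (f (x j)).coord v * a v)
      (fun v _ => mul_nonneg ((f (x j)).isBarycentric.nonneg v) (ha v)) (hx j)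
  have h3 : (f (x j)).coord (e j) * a (e j) = j := by
    simp only [a, hinj.extend_apply]
    field_simp [(hpos j).ne']
  linarith

/-- A map into a realization that uses finitely many vertices is continuous if its barycentric
coordinates are. -/
theorem continuous_of_continuous_coord {X : Type*} [TopologicalSpace X] {f : X → Realization K}
    {F : Finset V} (hF : ∀ x, (f x).coord.support ⊆ F)
    (hc : ∀ v, Continuous fun x => (f x).coord v) : Continuous f := by
  classical
  let A : {σ : Finset V // σ ∈ F.powerset} → Set X :=
    fun σ => {x | (f x).coord.support ⊆ σ.1 ∧ σ.1 ∈ K}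
  refine (locallyFinite_of_finite A).continuous ?_ ?_ ?_
  · rw [Set.eq_univ_iff_forall]
    intro x
    exact Set.mem_iUnion.2 ⟨⟨_, Finset.mem_powerset.2 (hF x)⟩, subset_rfl, (f x).support_mem⟩
  · rintro ⟨σ, -⟩
    by_cases hσ : σ ∈ K
    · have : A ⟨σ, ‹_›⟩ = ⋂ v ∈ {v | v ∉ σ}, {x | (f x).coord v = 0} := by
        ext x
        simp only [A, hσ, and_true, Set.mem_iInter]
        constructor
        · intro h v hv
          by_contra h'
          exact hv (h (Finsupp.mem_support_iff.2 h'))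
        · intro h v hv
          by_contra h'
          exact Finsupp.mem_support_iff.1 hv (h v h')
      rw [this]
      exact isClosed_biInter fun v _ => isClosed_eq (hc v) continuous_const
    · have : A ⟨σ, ‹_›⟩ = ∅ := by
        ext x; simp [A, hσ]
      rw [this]
      exact isClosed_empty
  · rintro ⟨σ, -⟩
    by_cases hσ : σ ∈ K
    · rw [continuousOn_iff_continuous_domRestrict]
      let h : A ⟨σ, ‹_›⟩ → ClosedSimplex K σ := fun x => ⟨f x.1, x.2.1⟩
      have hh : Continuous h := continuous_induced_rng.2
        (continuous_pi fun v => (hc v).comp continuous_subtype_val)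
      exact (continuous_closedSimplex_val hσ).comp hh
    · rintro x ⟨-, hx⟩
      exact absurd hx hσ

end Realization

/-! ### Free null-homotopies of cubes -/

section FreeNullHomotopy

open unitInterval Topology.Homotopy

variable {N Y : Type*} [TopologicalSpace Y]

/-- The piecewise linear map of the interval that expands by the factor `1 + u` around the
midpoint, cut off at the end points. -/
def expandInterval (u a : I) : I :=
  Set.projIcc 0 1 zero_le_one ((1 + (u : ℝ)) * a - u / 2)

theorem continuous_expandInterval : Continuous fun p : I × I => expandInterval p.1 p.2 := by
  unfold expandInterval
  exact continuous_projIcc.comp (by fun_prop)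

theorem expandInterval_zero_left (a : I) : expandInterval 0 a = a := by
  simp [expandInterval]

theorem expandInterval_zero_right (u : I) : expandInterval u 0 = 0 := by
  have := u.2.1
  refine (Set.projIcc_of_le_left _ ?_)
  simp only [Set.Icc.coe_zero]
  linarith

theorem expandInterval_one_right (u : I) : expandInterval u 1 = 1 := by
  have := u.2.1
  refine (Set.projIcc_of_right_le _ ?_)
  simp only [Set.Icc.coe_one]
  linarith

theorem expandInterval_mem_boundary (u : I) {t : N → I} (ht : t ∈ Cube.boundary N) :
    (fun l => expandInterval u (t l)) ∈ Cube.boundary N := by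
  obtain ⟨l, h | h⟩ := ht
  · exact ⟨l, Or.inl (by simp [h, expandInterval_zero_right])⟩
  · exact ⟨l, Or.inr (by simp [h, expandInterval_one_right])⟩

/-- A function on the cube that vanishes on the boundary and equals one on the inner cube, the
points which `expandInterval 1` does not send to the boundary. -/
def collarHeight [Fintype N] (t : N → I) : I :=
  Set.projIcc 0 1 zero_le_one (∏ l, min 1 (4 * min (t l : ℝ) (1 - t l)))

theorem continuous_collarHeight [Fintype N] :
    Continuous (collarHeight : (N → I) → I) := by
  unfold collarHeight
  exact continuous_projIcc.comp (continuous_finsetProd _ fun l _ => by fun_prop)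

theorem collarHeight_boundary [Fintype N] {t : N → I} (ht : t ∈ Cube.boundary N) :
    collarHeight t = 0 := by
  refine Set.projIcc_of_le_left _ (le_of_eq ?_)
  obtain ⟨l, h⟩ := ht
  refine Finset.prod_eq_zero (Finset.mem_univ l) ?_
  rcases h with h | h <;> simp [h]

theorem collarHeight_eq_one [Fintype N] {t : N → I}
    (ht : (fun l => expandInterval 1 (t l)) ∉ Cube.boundary N) : collarHeight t = 1 := by
  refine Set.projIcc_of_right_le _ (le_of_eq ?_)
  symm
  refine Finset.prod_eq_one fun l _ => ?_
  have h1 : ¬ (2 * (t l : ℝ) - 1 / 2 ≤ 0) := fun h => ht ⟨l, Or.inl (Set.projIcc_of_le_left _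
    (by simp only [Set.Icc.coe_one]; linarith))⟩
  have h2 : ¬ (1 ≤ 2 * (t l : ℝ) - 1 / 2) := fun h => ht ⟨l, Or.inr (Set.projIcc_of_right_le _
    (by simp only [Set.Icc.coe_one]; linarith))⟩
  rw [min_eq_left]
  rcases min_choice (t l : ℝ) (1 - t l) with h | h <;> rw [h] <;> linarith

/-- A loop `γ` on the cube is trivial in the homotopy group if it is null-homotopic through maps
that are constant on the boundary, along a path `β`: precede the homotopy by one that inserts a
collar, and use the collar to run back along `β`. -/
theorem genLoop_homotopic_const [Fintype N] {y : Y} (γ : Ω^ N Y y) (G : C(I × (N → I), Y))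
    (β : C(I, Y)) (hβ : β 0 = y) (h0 : ∀ t, G (0, t) = γ t) (h1 : ∀ t, G (1, t) = β 1)
    (hb : ∀ s, ∀ t ∈ Cube.boundary N, G (s, t) = β s) : GenLoop.Homotopic γ GenLoop.const := by
  let E : C(I × (N → I), N → I) :=
    ⟨fun p l => expandInterval p.1 (p.2 l), continuous_pi fun l =>
      continuous_expandInterval.comp (f := fun p : I × (N → I) => (p.1, p.2 l)) (by fun_prop)⟩
  let ρ : C(N → I, I) := ⟨collarHeight, continuous_collarHeight⟩
  have hE : ∀ u, ∀ t ∈ Cube.boundary N, E (u, t) ∈ Cube.boundary N := fun u t ht =>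
    expandInterval_mem_boundary u ht
  have hρ0 : ∀ t ∈ Cube.boundary N, ρ t = 0 := fun t ht => collarHeight_boundary ht
  have hρ1 : ∀ t, E (1, t) ∉ Cube.boundary N → ρ t = 1 := fun t ht => collarHeight_eq_one ht
  have hend : ∀ t, G (ρ t, E (1, t)) = β (ρ t) := by
    intro t
    by_cases h : E (1, t) ∈ Cube.boundary N
    · exact hb _ _ h
    · rw [hρ1 t h, h1]
  let γ₁ : Ω^ N Y y := ⟨⟨fun t => γ (E (1, t)), γ.1.continuous.comp (by fun_prop)⟩,
    fun t ht => γ.2 _ (hE 1 t ht)⟩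
  let γ₂ : Ω^ N Y y := ⟨⟨fun t => β (ρ t), by fun_prop⟩, fun t ht => by
    change β (ρ t) = y
    rw [hρ0 t ht, hβ]⟩
  have s1 : GenLoop.Homotopic γ γ₁ := ⟨{
    toFun := fun p => γ (E p)
    continuous_toFun := γ.1.continuous.comp (by fun_prop)
    map_zero_left := fun t => by
      change γ (E (0, t)) = γ t
      congr 1
      funext l
      exact expandInterval_zero_left _
    map_one_left := fun t => rfl
    prop' := fun u t ht => (γ.2 _ (hE u t ht)).trans (γ.2 _ ht).symm }⟩
  have s2 : GenLoop.Homotopic γ₁ γ₂ := ⟨{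
    toFun := fun p => G (min p.1 (ρ p.2), E (1, p.2))
    continuous_toFun := by fun_prop
    map_zero_left := fun t => by
      change G (min 0 (ρ t), E (1, t)) = γ (E (1, t))
      rw [min_eq_left unitInterval.nonneg', h0]
    map_one_left := fun t => by
      change G (min 1 (ρ t), E (1, t)) = β (ρ t)
      rw [min_eq_right unitInterval.le_one', hend]
    prop' := fun u t ht => by
      change G (min u (ρ t), E (1, t)) = γ (E (1, t))
      rw [hρ0 t ht, min_eq_right unitInterval.nonneg', h0] }⟩
  have s3 : GenLoop.Homotopic γ₂ GenLoop.const := ⟨{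
    toFun := fun p => β (min (σ p.1) (ρ p.2))
    continuous_toFun := by fun_prop
    map_zero_left := fun t => by
      change β (min (σ 0) (ρ t)) = β (ρ t)
      rw [unitInterval.symm_zero, min_eq_right unitInterval.le_one']
    map_one_left := fun t => by
      change β (min (σ 1) (ρ t)) = y
      rw [unitInterval.symm_one, min_eq_left unitInterval.nonneg', hβ]
    prop' := fun u t ht => by
      change β (min (σ u) (ρ t)) = β (ρ t)
      rw [hρ0 t ht, min_eq_right unitInterval.nonneg'] }⟩
  exact (s1.trans s2).trans s3

theorem subsingleton_pi_of_homotopic_const {i : ℕ} {y : Y}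
    (h : ∀ γ : Ω^ (Fin i) Y y, GenLoop.Homotopic γ GenLoop.const) : Subsingleton (π_ i Y y) := by
  constructor
  intro a b
  induction a using Quotient.inductionOn
  induction b using Quotient.inductionOn
  exact Quotient.sound ((h _).trans (h _).symm)

end FreeNullHomotopy

/-! ### Fine partitions of the cube of small order -/

section Grid

open unitInterval

variable {i : ℕ}

/-- A bump function supported on a cube of side `1 / N`, the one with index `c.2` in the grid
shifted by `c.1 / (i + 1)` grid units in every direction. -/
def gridBump (N : ℕ) (c : Fin (i + 1) × (Fin i → ℤ)) (t : Fin i → I) : ℝ :=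
  ∏ l, max 0 (1 / 2 - |N * (t l : ℝ) - (c.1 : ℝ) / (i + 1) - c.2 l - 1 / 2|)

/-- The grid cubes that meet the unit cube. -/
def gridIndex (i N : ℕ) : Finset (Fin (i + 1) × (Fin i → ℤ)) :=
  Finset.univ ×ˢ Fintype.piFinset fun _ => Finset.Icc (-1) (N : ℤ)

theorem continuous_gridBump (N : ℕ) (c : Fin (i + 1) × (Fin i → ℤ)) :
    Continuous (gridBump N c) :=
  continuous_finsetProd _ fun l _ => by fun_prop

theorem gridBump_nonneg (N : ℕ) (c : Fin (i + 1) × (Fin i → ℤ)) (t : Fin i → I) :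
    0 ≤ gridBump N c t :=
  Finset.prod_nonneg fun _ _ => le_max_left _ _

theorem gridBump_ne_zero_iff {N : ℕ} {c : Fin (i + 1) × (Fin i → ℤ)} {t : Fin i → I} :
    gridBump N c t ≠ 0 ↔ ∀ l, (c.2 l : ℝ) < N * (t l : ℝ) - (c.1 : ℝ) / (i + 1) ∧
      N * (t l : ℝ) - (c.1 : ℝ) / (i + 1) < c.2 l + 1 := by
  rw [gridBump, Finset.prod_ne_zero_iff]
  simp only [Finset.mem_univ, true_implies]
  refine forall_congr' fun l => ?_
  constructor
  · intro h
    have : 0 < 1 / 2 - |N * (t l : ℝ) - (c.1 : ℝ) / (i + 1) - c.2 l - 1 / 2| := by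
      by_contra h'
      exact h (max_eq_left (not_lt.1 h'))
    have := abs_lt.1 (sub_pos.1 this)
    constructor <;> linarith
  · rintro ⟨h1, h2⟩
    have : |N * (t l : ℝ) - (c.1 : ℝ) / (i + 1) - c.2 l - 1 / 2| < 1 / 2 :=
      abs_lt.2 ⟨by linarith, by linarith⟩
    exact (lt_max_of_lt_right (sub_pos.2 this)).ne'

/-- Each of the `i` coordinates of a point can lie on the walls of at most one of the `i + 1`
grids, so the point is interior to a cube of some grid. -/
theorem exists_gridBump_pos (N : ℕ) (t : Fin i → I) :
    ∃ c ∈ gridIndex i N, 0 < gridBump N c t := by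
  have hi : (0 : ℝ) < i + 1 := by positivity
  obtain ⟨j, hj⟩ : ∃ j : Fin (i + 1), ∀ l,
      (⌊N * (t l : ℝ) - (j : ℝ) / (i + 1)⌋ : ℝ) ≠ N * (t l : ℝ) - (j : ℝ) / (i + 1) := by
    by_contra! hcon
    choose l hl using hcon
    obtain ⟨j, j', hne, hjj⟩ := Fintype.exists_ne_map_eq_of_card_lt l (by simp)
    have h1 := hl j
    have h2 := hl j'
    rw [← hjj] at h2
    set a := ⌊N * (t (l j) : ℝ) - (j : ℝ) / (i + 1)⌋
    set b := ⌊N * (t (l j) : ℝ) - (j' : ℝ) / (i + 1)⌋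
    have h3 : ((b - a) * (i + 1) : ℝ) = j - j' := by
      rw [h1, h2]
      field_simp
      ring
    have h4 : (b - a) * ((i : ℤ) + 1) = (j : ℤ) - j' := by exact_mod_cast h3
    have h5 : |(j : ℤ) - j'| < (i : ℤ) + 1 := by
      rw [abs_lt]
      constructor <;> omega
    have h6 : (j : ℤ) - j' = 0 := Int.eq_zero_of_abs_lt_dvd (Dvd.intro_left _ h4) h5
    exact hne (Fin.ext (by omega))
  refine ⟨(j, fun l => ⌊N * (t l : ℝ) - (j : ℝ) / (i + 1)⌋), ?_, ?_⟩
  · simp only [gridIndex, Finset.mem_product, Finset.mem_univ, true_and, Fintype.mem_piFinset,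
      Finset.mem_Icc]
    intro l
    have h1 : (j : ℝ) / (i + 1) ≤ 1 := by
      rw [div_le_one hi]
      have : (j : ℕ) ≤ i := by omega
      exact_mod_cast this.trans (Nat.le_succ i)
    have h2 : 0 ≤ (j : ℝ) / (i + 1) := by positivity
    have h3 := (t l).2.1
    have h4 := (t l).2.2
    have h5 : (0 : ℝ) ≤ N := by positivity
    constructor
    · rw [Int.le_floor]
      push_cast
      nlinarith
    · rw [Int.floor_le_iff]
      push_cast
      nlinarith
  · refine (gridBump_nonneg _ _ _).lt_of_ne' (gridBump_ne_zero_iff.2 fun l => ⟨?_, ?_⟩)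
    · exact lt_of_le_of_ne (Int.floor_le _) (hj l)
    · exact Int.lt_floor_add_one _

theorem card_gridBump_ne_zero_le (N : ℕ) (s : Finset (Fin (i + 1) × (Fin i → ℤ)))
    (t : Fin i → I) : (s.filter fun c => gridBump N c t ≠ 0).card ≤ i + 1 := by
  have : Set.InjOn Prod.fst
      (s.filter fun c => gridBump N c t ≠ 0 : Set (Fin (i + 1) × (Fin i → ℤ))) := by
    intro c hc d hd hcd
    simp only [Finset.coe_filter, Set.mem_ofPred_eq] at hc hd
    refine Prod.ext hcd (funext fun l => ?_)
    have h1 := gridBump_ne_zero_iff.1 hc.2 l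
    have h2 := gridBump_ne_zero_iff.1 hd.2 l
    rw [hcd] at h1
    have h3 : (c.2 l : ℝ) < d.2 l + 1 := by linarith
    have h4 : (d.2 l : ℝ) < c.2 l + 1 := by linarith
    have h3' : c.2 l < d.2 l + 1 := by exact_mod_cast h3
    have h4' : d.2 l < c.2 l + 1 := by exact_mod_cast h4
    omega
  calc _ ≤ (Finset.univ : Finset (Fin (i + 1))).card :=
        Finset.card_le_card_of_injOn Prod.fst (fun _ _ => by simp) this
    _ = i + 1 := by simp

theorem dist_le_of_gridBump_ne_zero {N : ℕ} (hN : 0 < N) {c : Fin (i + 1) × (Fin i → ℤ)}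
    {t t' : Fin i → I} (h : gridBump N c t ≠ 0) (h' : gridBump N c t' ≠ 0) :
    dist t t' ≤ 1 / N := by
  rw [dist_pi_le_iff (by positivity)]
  intro l
  have h1 := gridBump_ne_zero_iff.1 h l
  have h2 := gridBump_ne_zero_iff.1 h' l
  have hN' : (0 : ℝ) < N := by exact_mod_cast hN
  rw [Subtype.dist_eq, Real.dist_eq, le_div_iff₀ hN', ← abs_of_pos hN', ← abs_mul]
  rw [abs_le]
  constructor <;> linarith

end Grid

/-! ### Complexes with a complete skeleton -/

theorem IsBarycentric.eq_single {V : Type*} {p : V →₀ ℝ} (hp : IsBarycentric p) {v : V}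
    (h : ∀ w ∈ p.support, w = v) : p = Finsupp.single v 1 := by
  classical
  have hsub : p.support ⊆ {v} := fun w hw => Finset.mem_singleton.2 (h w hw)
  ext w
  rw [Finsupp.single_apply]
  split_ifs with hw
  · subst hw
    simpa using hp.sum_of_subset hsub
  · by_contra h'
    exact hw (h w (Finsupp.mem_support_iff.2 h')).symm

/-- The path from `p` through `q` to the vertex `v`, straight on both halves. -/
def twoStep {V : Type*} (s : ℝ) (p q : V →₀ ℝ) (v : V) : V →₀ ℝ :=
  (1 - min 1 (2 * s)) • p +
    min 1 (2 * s) • ((1 - max 0 (2 * s - 1)) • q + max 0 (2 * s - 1) • Finsupp.single v 1)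

section twoStep

variable {V : Type*} {p q : V →₀ ℝ} {v : V} {s : ℝ}

theorem isBarycentric_twoStep (hp : IsBarycentric p) (hq : IsBarycentric q)
    (hs : s ∈ unitInterval) :
    IsBarycentric (twoStep s p q v) := by
  refine hp.combination (hq.combination (.single v) ?_ ?_ ?_) ?_ ?_ ?_
  · rw [sub_nonneg]; exact max_le zero_le_one (by linarith [hs.2])
  · exact le_max_left _ _
  · ring
  · rw [sub_nonneg]; exact min_le_left _ _
  · exact le_min zero_le_one (by linarith [hs.1])
  · ring

theorem support_twoStep_mem {K : PreAbstractSimplicialComplex V} [DecidableEq V]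
    (hp : p.support ∈ K) (hqp : q.support ⊆ p.support) (hq : insert v q.support ∈ K)
    (hne : (twoStep s p q v).support.Nonempty) : (twoStep s p q v).support ∈ K := by
  rcases lt_or_ge (2 * s) 1 with h | h
  · refine (K.isRelLowerSet_faces hp).2 (fun w hw => ?_) hne
    rcases mem_support_combination hw with h1 | h1
    · exact h1.2
    · rcases mem_support_combination h1.2 with h2 | h2
      · exact hqp h2.2
      · exact absurd (max_eq_left (by linarith)) h2.1
  · refine (K.isRelLowerSet_faces hq).2 (fun w hw => ?_) hne
    rcases mem_support_combination hw with h1 | h1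
    · exact absurd (by rw [min_eq_left h, sub_self]) h1.1
    · rcases mem_support_combination h1.2 with h2 | h2
      · exact Finset.mem_insert_of_mem h2.2
      · have := Finsupp.support_single_subset h2.2
        rw [Finset.mem_singleton.1 this]
        exact Finset.mem_insert_self _ _

theorem support_twoStep_subset [DecidableEq V] :
    (twoStep s p q v).support ⊆ insert v (p.support ∪ q.support) := by
  intro w hw
  rcases mem_support_combination hw with h1 | h1
  · simp [h1.2]
  · rcases mem_support_combination h1.2 with h2 | h2
    · simp [h2.2]
    · have := Finsupp.support_single_subset h2.2
      simp [Finset.mem_singleton.1 this]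

theorem twoStep_zero : twoStep 0 p q v = p := by simp [twoStep]

theorem twoStep_one : twoStep 1 p q v = Finsupp.single v 1 := by
  norm_num [twoStep]

theorem continuous_twoStep_apply {X : Type*} [TopologicalSpace X] {s : X → ℝ} {p q : X → V →₀ ℝ}
    {w : V} (hs : Continuous s) (hp : Continuous fun x => p x w)
    (hq : Continuous fun x => q x w) : Continuous fun x => twoStep (s x) (p x) (q x) v w := by
  simp only [twoStep, Finsupp.add_apply, Finsupp.smul_apply, smul_eq_mul]
  fun_prop

end twoStep

section Skeleton

open unitInterval Topology.Homotopy

theorem isClosed_cube_boundary (i : ℕ) : IsClosed (Cube.boundary (Fin i)) := by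
  have : Cube.boundary (Fin i) = ⋃ l, {t : Fin i → I | t l = 0} ∪ {t | t l = 1} := by
    ext t; simp [Cube.boundary]
  rw [this]
  exact isClosed_iUnion_of_finite fun l =>
    (isClosed_eq (continuous_apply l) continuous_const).union
      (isClosed_eq (continuous_apply l) continuous_const)

/-- For a fine grid, the vertices `v c` of the complex can be chosen so that a map of the cube sends
the support of every bump function into the open star of the chosen vertex; near the boundary,
which goes to one point, the same vertex can be chosen everywhere. -/
theorem exists_grid_labelling {V : Type*} {K : PreAbstractSimplicialComplex V} {i : ℕ}
    {y : Realization K} (γ : Ω^ (Fin i) (Realization K) y) {v₀ : V} (hv₀ : v₀ ∈ y.coord.support) :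
    ∃ (N : ℕ) (v : Fin (i + 1) × (Fin i → ℤ) → V), ∀ c t, gridBump N c t ≠ 0 →
      v c ∈ (γ t).coord.support ∧ (t ∈ Cube.boundary (Fin i) → v c = v₀) := by
  classical
  let U : V → Set (Fin i → I) := fun v => {t | 0 < (γ t).coord v}
  have hU : ∀ v, IsOpen (U v) := fun v =>
    isOpen_lt continuous_const ((Realization.continuous_coord v).comp γ.1.continuous)
  obtain ⟨ε₁, hε₁, h₁⟩ := lebesgue_number_lemma_of_metric (c := U) isCompact_univ hU (by
    intro t _
    obtain ⟨v, hv⟩ := (γ t).isBarycentric.support_nonempty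
    exact Set.mem_iUnion.2 ⟨v, (γ t).isBarycentric.mem_support_iff.1 hv⟩)
  have hsub : Cube.boundary (Fin i) ⊆ U v₀ := fun t ht => by
    change 0 < (γ t).coord v₀
    rw [GenLoop.boundary γ t ht]
    exact y.isBarycentric.mem_support_iff.1 hv₀
  obtain ⟨ε₂, hε₂, h₂⟩ :=
    (isClosed_cube_boundary i).isCompact.exists_thickening_subset_open (hU v₀) hsub
  obtain ⟨n, hn⟩ := exists_nat_one_div_lt (lt_min hε₁ hε₂)
  have hd : ∀ (c : _ × (Fin i → ℤ)) t t', gridBump (n + 1) c t ≠ 0 →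
      gridBump (n + 1) c t' ≠ 0 →
      dist t t' < min ε₁ ε₂ := fun c t t' ht ht' =>
    (dist_le_of_gridBump_ne_zero n.succ_pos ht ht').trans_lt (by exact_mod_cast hn)
  choose w hw using fun t => h₁ t (Set.mem_univ t)
  refine ⟨n + 1, fun c =>
    if h : ∃ t, gridBump (n + 1) c t ≠ 0 ∧ t ∉ Cube.boundary (Fin i) ∧
      ∀ t' ∈ Cube.boundary (Fin i), gridBump (n + 1) c t' = 0 then w h.choose else v₀, ?_⟩
  intro c t ht
  dsimp only
  split_ifs with h
  · obtain ⟨h3, -, h4⟩ := h.choose_spec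
    refine ⟨(γ t).isBarycentric.mem_support_iff.2 ?_, fun ht' => absurd (h4 t ht') ht⟩
    exact hw _ (Metric.mem_ball.2 ((hd c t _ ht h3).trans_le (min_le_left _ _)))
  · refine ⟨(γ t).isBarycentric.mem_support_iff.2 ?_, fun _ => rfl⟩
    by_cases hb : ∃ t' ∈ Cube.boundary (Fin i), gridBump (n + 1) c t' ≠ 0
    · obtain ⟨t', ht', hc⟩ := hb
      refine h₂ (Metric.mem_thickening_iff.2 ⟨t', ht', ?_⟩)
      exact (hd c t t' ht hc).trans_le (min_le_right _ _)
    · push Not at hb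
      by_cases htb : t ∈ Cube.boundary (Fin i)
      · exact absurd (hb t htb) ht
      · exact absurd ⟨t, ht, htb, hb⟩ h

/-- If all sets of at most `i + 2` vertices are faces, the `i`-th homotopy group is trivial: a map
of the `i`-cube can be pushed into the `i`-skeleton, and there is room for a cone over that. -/
theorem subsingleton_pi_of_card_le {V : Type*} {K : PreAbstractSimplicialComplex V} {i : ℕ}
    (hK : ∀ τ : Finset V, τ.Nonempty → τ.card ≤ i + 2 → τ ∈ K) (y : Realization K) :
    Subsingleton (π_ i (Realization K) y) := by
  classical
  refine subsingleton_pi_of_homotopic_const fun γ => ?_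
  obtain ⟨v₀, hv₀⟩ := y.isBarycentric.support_nonempty
  obtain ⟨N, v, hv⟩ := exists_grid_labelling γ hv₀
  obtain ⟨F, hF⟩ := Realization.exists_finset_support_subset γ.1.continuous
  let q : (Fin i → I) → V →₀ ℝ := fun t => vertexAverage (gridIndex i N) (fun c => gridBump N c t) v
  have hq : ∀ t, IsBarycentric (q t) := fun t =>
    isBarycentric_vertexAverage (fun c _ => gridBump_nonneg N c t) (exists_gridBump_pos N t)
  have hqγ : ∀ t, (q t).support ⊆ (γ t).coord.support := fun t w hw => by
    obtain ⟨c, -, hc, rfl⟩ := exists_of_mem_support_vertexAverage hw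
    exact (hv c t hc).1
  have hqcard : ∀ t, (insert v₀ (q t).support).card ≤ i + 2 := fun t => by
    have h1 : (q t).support ⊆ ((gridIndex i N).filter fun c => gridBump N c t ≠ 0).image v := by
      intro w hw
      obtain ⟨c, hc, hc', rfl⟩ := exists_of_mem_support_vertexAverage hw
      exact Finset.mem_image_of_mem _ (Finset.mem_filter.2 ⟨hc, hc'⟩)
    have h2 := (Finset.card_le_card h1).trans
      (Finset.card_image_le.trans (card_gridBump_ne_zero_le N _ t))
    exact (Finset.card_insert_le _ _).trans (by omega)
  have hqK : ∀ t, insert v₀ (q t).support ∈ K := fun t =>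
    hK _ (Finset.insert_nonempty _ _) (hqcard t)
  have hqb : ∀ t ∈ Cube.boundary (Fin i), q t = Finsupp.single v₀ 1 := fun t ht =>
    (hq t).eq_single fun w hw => by
      obtain ⟨c, -, hc, rfl⟩ := exists_of_mem_support_vertexAverage hw
      exact (hv c t hc).2 ht
  have hqc : ∀ w, Continuous fun t => q t w := fun w =>
    continuous_vertexAverage_apply (fun c _ => continuous_gridBump N c)
      (fun t => (Finset.sum_pos' (fun c _ => gridBump_nonneg N c t)
        (exists_gridBump_pos N t)).ne') w
  -- the homotopy from `γ` through `q` to the vertex `v₀`, and its restriction to the boundary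
  let G : I × (Fin i → I) → Realization K := fun p =>
    .ofCoord (twoStep p.1 (γ p.2).coord (q p.2) v₀)
      (isBarycentric_twoStep (γ p.2).isBarycentric (hq p.2) p.1.2)
      (support_twoStep_mem (γ p.2).support_mem (hqγ p.2) (hqK p.2)
        (isBarycentric_twoStep (γ p.2).isBarycentric (hq p.2) p.1.2).support_nonempty)
  have hG : Continuous G := by
    refine Realization.continuous_of_continuous_coord (F := insert v₀ F) (fun p => ?_) fun w => ?_
    · refine support_twoStep_subset.trans (Finset.insert_subset_insert _ ?_)
      exact Finset.union_subset (hF _) ((hqγ _).trans (hF _))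
    · exact continuous_twoStep_apply (by fun_prop)
        (((Realization.continuous_coord w).comp γ.1.continuous).comp continuous_snd)
        ((hqc w).comp continuous_snd)
  have hv₀K : insert v₀ (Finsupp.single v₀ (1 : ℝ)).support ∈ K :=
    hK _ (Finset.insert_nonempty _ _) (by
      rw [Finsupp.support_single _ one_ne_zero]
      simp)
  have hv₀y : (Finsupp.single v₀ (1 : ℝ)).support ⊆ y.coord.support := by
    rw [Finsupp.support_single _ one_ne_zero]
    simpa using hv₀
  let β : I → Realization K := fun s =>
    .ofCoord (twoStep s y.coord (Finsupp.single v₀ 1) v₀)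
      (isBarycentric_twoStep y.isBarycentric (.single v₀) s.2)
      (support_twoStep_mem y.support_mem hv₀y hv₀K
        (isBarycentric_twoStep y.isBarycentric (.single v₀) s.2).support_nonempty)
  have hβ : Continuous β := by
    refine Realization.continuous_of_continuous_coord (F := y.coord.support) (fun p => ?_)
      fun w => continuous_twoStep_apply (by fun_prop) continuous_const continuous_const
    refine support_twoStep_subset.trans (Finset.insert_subset hv₀ ?_)
    exact Finset.union_subset subset_rfl hv₀y
  refine genLoop_homotopic_const γ ⟨G, hG⟩ ⟨β, hβ⟩ ?_ ?_ ?_ ?_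
  · exact Realization.ext_coord twoStep_zero
  · exact fun t => Realization.ext_coord twoStep_zero
  · exact fun t => Realization.ext_coord (twoStep_one.trans twoStep_one.symm)
  · intro s t ht
    refine Realization.ext_coord ?_
    change twoStep s (γ t).coord (q t) v₀ = twoStep s y.coord (Finsupp.single v₀ 1) v₀
    rw [hqb t ht, GenLoop.boundary γ t ht]

end Skeleton

/-! ### Extension of maps of spheres over balls -/

section Wrap

variable {X : Type*} [NormedAddCommGroup X] [NormedSpace ℝ X]

/-- A map from the unit ball of `X` to `X × ℝ` such that every ray from the origin of `X × ℝ` is met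
exactly once, except that the unit sphere is collapsed to the point `(0, -1)`. -/
def wrap (x : X) : X × ℝ := ((1 - ‖x‖) • x, 1 - 2 * ‖x‖)

theorem continuous_wrap : Continuous (wrap : X → X × ℝ) := by
  unfold wrap
  fun_prop

theorem wrap_of_norm_eq_one {x : X} (hx : ‖x‖ = 1) : wrap x = (0, -1) := by
  norm_num [wrap, hx]

theorem norm_wrap_fst {x : X} (hx : ‖x‖ ≤ 1) : ‖(wrap x).1‖ = (1 - ‖x‖) * ‖x‖ := by
  rw [wrap, norm_smul, Real.norm_of_nonneg (by linarith)]

theorem wrap_ne_zero {x : X} (hx : ‖x‖ ≤ 1) : wrap x ≠ 0 := by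
  intro h
  have h1 : 1 - 2 * ‖x‖ = 0 := congrArg Prod.snd h
  have h2 := norm_wrap_fst hx
  rw [h, Prod.fst_zero, norm_zero] at h2
  have : ‖x‖ = 1 / 2 := by linarith
  norm_num [this] at h2

theorem wrap_eq_smul_wrap {x x' : X} (hx : ‖x‖ ≤ 1) (hx' : ‖x'‖ ≤ 1) {c : ℝ} (hc : 0 < c)
    (h : wrap x = c • wrap x') : x = x' ∨ ‖x‖ = 1 ∧ ‖x'‖ = 1 := by
  have h1 : (1 - ‖x‖) * ‖x‖ = c * ((1 - ‖x'‖) * ‖x'‖) := by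
    rw [← norm_wrap_fst hx, h, Prod.smul_fst, norm_smul, norm_wrap_fst hx',
      Real.norm_of_nonneg hc.le]
  have h2 : 1 - 2 * ‖x‖ = c * (1 - 2 * ‖x'‖) := congrArg Prod.snd h
  have h3 : (1 - ‖x‖) • x = c • (1 - ‖x'‖) • x' := congrArg Prod.fst h
  generalize hm : ‖x‖ = m at *
  generalize hm' : ‖x'‖ = m' at *
  have h0 : 0 ≤ m := hm ▸ norm_nonneg x
  have h0' : 0 ≤ m' := hm' ▸ norm_nonneg x'
  have hmm : m = m' := by
    have e : (m' - m) * ((1 - m) * (1 - m') + m * m') = 0 := by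
      have : (1 - 2 * m) * (c * ((1 - m') * m')) = c * (1 - 2 * m') * ((1 - m) * m) := by
        rw [← h1, h2]
      have := mul_left_cancel₀ hc.ne' (a := c)
        (b := (1 - 2 * m) * ((1 - m') * m')) (c := (1 - 2 * m') * ((1 - m) * m)) (by linarith)
      linarith
    rcases mul_eq_zero.1 e with h | h
    · linarith
    · have p1 : 0 ≤ (1 - m) * (1 - m') := mul_nonneg (by linarith) (by linarith)
      have p2 : 0 ≤ m * m' := mul_nonneg h0 h0'
      have q1 : (1 - m) * (1 - m') = 0 := by linarith
      have q2 : m * m' = 0 := by linarith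
      -- otherwise the two points are the center and a boundary point, on opposite rays
      rcases mul_eq_zero.1 q1 with r1 | r1 <;> rcases mul_eq_zero.1 q2 with r2 | r2
      · linarith
      · have : m = 1 := by linarith
        rw [this, r2] at h2
        linarith
      · have : m' = 1 := by linarith
        rw [this, r2] at h2
        linarith
      · linarith
  subst hmm
  rcases eq_or_ne m 1 with h | h
  · exact Or.inr ⟨h, h⟩
  · left
    have hc1 : c = 1 := by
      have e : (c - 1) * (1 - 2 * m) = 0 := by linarith
      rcases mul_eq_zero.1 e with h' | h'
      · linarith
      · have : m = 1 / 2 := by linarith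
        rw [this] at h1
        linarith
    rw [hc1, one_smul] at h3
    exact smul_right_injective X (sub_ne_zero.2 h.symm) h3

theorem exists_wrap_eq_smul [Nontrivial X] {z : X × ℝ} (hz : z ≠ 0) :
    ∃ x : X, ‖x‖ ≤ 1 ∧ ∃ c : ℝ, 0 < c ∧ wrap x = c • z := by
  obtain ⟨y, t⟩ := z
  rcases eq_or_ne y 0 with rfl | hy
  · have ht : t ≠ 0 := fun h => hz (by rw [h]; rfl)
    rcases ht.lt_or_gt with h | h
    · obtain ⟨x, hx⟩ := exists_norm_eq X (zero_le_one (α := ℝ))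
      refine ⟨x, hx.le, -t⁻¹, neg_pos.2 (inv_lt_zero.2 h), ?_⟩
      rw [wrap_of_norm_eq_one hx]
      simp [h.ne]
    · refine ⟨0, by simp, t⁻¹, by positivity, ?_⟩
      simp [wrap, h.ne']
  · have ha : 0 < ‖y‖ := norm_pos_iff.2 hy
    obtain ⟨m, ⟨hm0, hm1⟩, hm⟩ : (0 : ℝ) ∈ (fun m => ‖y‖ * (1 - 2 * m) - t * (m * (1 - m))) ''
        Set.Icc 0 1 := by
      refine intermediate_value_Icc' zero_le_one (by fun_prop) ⟨?_, ?_⟩ <;> norm_num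
    simp only at hm
    have hmp : 0 < m := by
      refine hm0.lt_of_ne fun h => ?_
      rw [← h] at hm
      linarith
    have hml : m < 1 := by
      refine hm1.lt_of_ne fun h => ?_
      rw [h] at hm
      linarith
    have hn : ‖(m / ‖y‖) • y‖ = m := by
      rw [norm_smul, Real.norm_of_nonneg (by positivity)]
      field_simp
    refine ⟨(m / ‖y‖) • y, hn.trans_le hm1, m * (1 - m) / ‖y‖,
      div_pos (mul_pos hmp (by linarith)) ha, ?_⟩
    rw [wrap, hn, Prod.smul_mk, smul_smul]
    congr 1
    · congr 1; ring
    · rw [smul_eq_mul]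
      field_simp
      linarith

end Wrap

section Extension

open unitInterval Topology.Homotopy

/-- The affine map from the cube onto the unit ball of the sup norm. -/
def cubeToBall {i : ℕ} (t : Fin i → I) : Fin i → ℝ := fun l => 2 * (t l : ℝ) - 1

variable {i : ℕ}

theorem continuous_cubeToBall : Continuous (cubeToBall (i := i)) := by
  unfold cubeToBall
  fun_prop

theorem abs_two_mul_sub_one_le (a : I) : |2 * (a : ℝ) - 1| ≤ 1 := by
  have := a.2.1
  have := a.2.2
  rw [abs_le]
  constructor <;> linarith

theorem norm_cubeToBall_le (t : Fin i → I) : ‖cubeToBall t‖ ≤ 1 :=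
  (pi_norm_le_iff_of_nonneg zero_le_one).2 fun l => abs_two_mul_sub_one_le (t l)

theorem cubeToBall_injective : Function.Injective (cubeToBall (i := i)) := by
  intro t t' h
  funext l
  have := congrFun h l
  simp only [cubeToBall] at this
  exact Subtype.ext (by linarith)

theorem exists_cubeToBall_eq {x : Fin i → ℝ} (hx : ‖x‖ ≤ 1) : ∃ t, cubeToBall t = x := by
  have h : ∀ l, |x l| ≤ 1 := fun l => (norm_le_pi_norm x l).trans hx
  refine ⟨fun l => ⟨(x l + 1) / 2, ?_, ?_⟩, ?_⟩
  · linarith [(abs_le.1 (h l)).1]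
  · linarith [(abs_le.1 (h l)).2]
  · funext l
    simp only [cubeToBall]
    ring

theorem norm_cubeToBall_eq_one_iff {t : Fin i → I} :
    ‖cubeToBall t‖ = 1 ↔ t ∈ Cube.boundary (Fin i) := by
  have hend : ∀ a : I, |2 * (a : ℝ) - 1| = 1 ↔ a = 0 ∨ a = 1 := by
    intro a
    rw [abs_eq zero_le_one, or_comm, ← Set.Icc.coe_eq_zero, ← Set.Icc.coe_eq_one]
    constructor <;> rintro (h | h)
    · left; linarith
    · right; linarith
    · left; linarith
    · right; linarith
  constructor
  · intro h
    by_contra hb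
    have : ‖cubeToBall t‖ < 1 := by
      rw [pi_norm_lt_iff zero_lt_one]
      intro l
      refine (abs_two_mul_sub_one_le (t l)).lt_of_ne fun h' => hb ⟨l, (hend _).1 h'⟩
    linarith
  · rintro ⟨l, hl⟩
    refine le_antisymm (norm_cubeToBall_le t) ?_
    rw [← (hend _).2 hl]
    exact norm_le_pi_norm (cubeToBall t) l

/-- The map from the `i`-cube to the unit sphere in `ℝ^i × ℝ` that collapses the boundary of the
cube to the south pole. It is onto if `i > 0`; for `i = 0` it misses the south pole. -/
def cubeToSphere (t : Fin i → I) : (Fin i → ℝ) × ℝ :=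
  ‖wrap (cubeToBall t)‖⁻¹ • wrap (cubeToBall t)

theorem norm_wrap_cubeToBall_pos (t : Fin i → I) : 0 < ‖wrap (cubeToBall t)‖ :=
  norm_pos_iff.2 (wrap_ne_zero (norm_cubeToBall_le t))

theorem continuous_cubeToSphere : Continuous (cubeToSphere (i := i)) := by
  have h : Continuous fun t : Fin i → I => wrap (cubeToBall t) :=
    continuous_wrap.comp continuous_cubeToBall
  exact (h.norm.inv₀ fun t => (norm_wrap_cubeToBall_pos t).ne').smul h

theorem norm_cubeToSphere (t : Fin i → I) : ‖cubeToSphere t‖ = 1 := by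
  rw [cubeToSphere, norm_smul, norm_inv, norm_norm, inv_mul_cancel₀]
  exact (norm_wrap_cubeToBall_pos t).ne'

theorem cubeToSphere_boundary {t : Fin i → I} (ht : t ∈ Cube.boundary (Fin i)) :
    cubeToSphere t = (0, -1) := by
  rw [cubeToSphere, wrap_of_norm_eq_one (norm_cubeToBall_eq_one_iff.2 ht)]
  simp [Prod.norm_def]

theorem cubeToSphere_eq {t t' : Fin i → I} (h : cubeToSphere t = cubeToSphere t') :
    t = t' ∨ t ∈ Cube.boundary (Fin i) ∧ t' ∈ Cube.boundary (Fin i) := by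
  have h1 := norm_wrap_cubeToBall_pos t
  have h2 := norm_wrap_cubeToBall_pos t'
  have h3 : wrap (cubeToBall t) =
      (‖wrap (cubeToBall t)‖ * ‖wrap (cubeToBall t')‖⁻¹) • wrap (cubeToBall t') := by
    have := congrArg (‖wrap (cubeToBall t)‖ • ·) h
    simp only [cubeToSphere, smul_smul] at this
    rwa [mul_inv_cancel₀ h1.ne', one_smul] at this
  rcases wrap_eq_smul_wrap (norm_cubeToBall_le t) (norm_cubeToBall_le t') (by positivity) h3
    with h | ⟨h, h'⟩
  · exact Or.inl (cubeToBall_injective h)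
  · exact Or.inr ⟨norm_cubeToBall_eq_one_iff.1 h, norm_cubeToBall_eq_one_iff.1 h'⟩

theorem exists_cubeToSphere_eq (hi : 0 < i) {z : (Fin i → ℝ) × ℝ} (hz : ‖z‖ = 1) :
    ∃ t, cubeToSphere t = z := by
  have : Nonempty (Fin i) := ⟨⟨0, hi⟩⟩
  obtain ⟨x, hx, c, hc, h⟩ := exists_wrap_eq_smul (z := z) (by rintro rfl; simp at hz)
  obtain ⟨t, rfl⟩ := exists_cubeToBall_eq hx
  refine ⟨t, ?_⟩
  rw [cubeToSphere, h, norm_smul, hz, mul_one, Real.norm_of_nonneg hc.le, smul_smul,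
    inv_mul_cancel₀ hc.ne', one_smul]

/-- The cone over `cubeToSphere`, a quotient map from `I × I^i` to the `(i + 1)`-ball if `i > 0`. -/
def coneToBall (p : I × (Fin i → I)) : Metric.closedBall (0 : (Fin i → ℝ) × ℝ) 1 :=
  ⟨(1 - (p.1 : ℝ)) • cubeToSphere p.2, by
    have := p.1.2.1
    have := p.1.2.2
    rw [mem_closedBall_zero_iff, norm_smul, norm_cubeToSphere, mul_one, Real.norm_of_nonneg]
    all_goals linarith⟩

theorem norm_coneToBall (p : I × (Fin i → I)) : ‖(coneToBall p : (Fin i → ℝ) × ℝ)‖ = 1 - p.1 := by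
  have := p.1.2.2
  rw [coneToBall, norm_smul, norm_cubeToSphere, mul_one, Real.norm_of_nonneg (by linarith)]

theorem isQuotientMap_coneToBall (hi : 0 < i) :
    Topology.IsQuotientMap (coneToBall (i := i)) := by
  have hc : Continuous (coneToBall (i := i)) :=
    Continuous.subtype_mk
      (Continuous.smul (f := fun p : I × (Fin i → I) => 1 - (p.1 : ℝ)) (by fun_prop)
        (continuous_cubeToSphere.comp continuous_snd)) _
  refine hc.isClosedMap.isQuotientMap hc ?_
  rintro ⟨z, hz⟩
  rw [mem_closedBall_zero_iff] at hz
  rcases eq_or_ne z 0 with rfl | h0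
  · exact ⟨(1, fun _ => 0), Subtype.ext (by simp [coneToBall])⟩
  · have hpos := norm_pos_iff.2 h0
    obtain ⟨t, ht⟩ := exists_cubeToSphere_eq hi (z := ‖z‖⁻¹ • z) (by
      rw [norm_smul, norm_inv, norm_norm, inv_mul_cancel₀ hpos.ne'])
    refine ⟨(⟨1 - ‖z‖, by linarith, by linarith⟩, t), Subtype.ext ?_⟩
    simp [coneToBall, ht, smul_smul, hpos.ne']

/-- If the `i`-th homotopy groups are trivial, every map of an `i`-sphere extends over the ball. -/
theorem exists_extension_closedBall {Y : Type*} [TopologicalSpace Y]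
    (hπ : ∀ y : Y, Subsingleton (π_ i Y y)) {f : (Fin i → ℝ) × ℝ → Y}
    (hf : ContinuousOn f (Metric.sphere 0 1)) :
    ∃ g : (Fin i → ℝ) × ℝ → Y, ContinuousOn g (Metric.closedBall 0 1) ∧
      ∀ z ∈ Metric.sphere 0 1, g z = f z := by
  have hπ' : ∀ (y : Y) (γ γ' : Ω^ (Fin i) Y y), GenLoop.Homotopic γ γ' := fun y γ γ' =>
    Quotient.exact ((hπ y).elim (Quotient.mk _ γ) (Quotient.mk _ γ'))
  rcases Nat.eq_zero_or_pos i with rfl | hi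
  · have hb : ∀ t, t ∉ Cube.boundary (Fin 0) := fun t ht => ht.choose.elim0
    obtain ⟨H⟩ := hπ' (f (0, -1)) ⟨ContinuousMap.const _ (f (0, 1)), fun t ht => absurd ht (hb t)⟩
      GenLoop.const
    refine ⟨fun z => H (Set.projIcc 0 1 zero_le_one ((1 - z.2) / 2), default), ?_, ?_⟩
    · refine (H.continuous.comp (Continuous.prodMk ?_ continuous_const)).continuousOn
      exact continuous_projIcc.comp (by fun_prop)
    · rintro ⟨x, t⟩ hz
      obtain rfl : x = 0 := Subsingleton.elim _ _
      have ht : |t| = 1 := by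
        rw [mem_sphere_zero_iff_norm, Prod.norm_mk, norm_zero, max_eq_right (norm_nonneg t)] at hz
        exact hz
      rcases (abs_eq zero_le_one).1 ht with rfl | rfl
      · have : Set.projIcc (0 : ℝ) 1 zero_le_one ((1 - 1) / 2) = 0 := by
          norm_num
        simp only [this]
        exact H.map_zero_left _
      · have : Set.projIcc (0 : ℝ) 1 zero_le_one ((1 - -1) / 2) = 1 := by
          norm_num
        simp only [this]
        exact H.map_one_left _
  · let γ : Ω^ (Fin i) Y (f (0, -1)) := ⟨⟨fun t => f (cubeToSphere t),
      hf.comp_continuous continuous_cubeToSphere fun t => by simp [norm_cubeToSphere]⟩,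
      fun t ht => congrArg f (cubeToSphere_boundary ht)⟩
    obtain ⟨H⟩ := hπ' _ γ GenLoop.const
    have hq := isQuotientMap_coneToBall hi
    let q : C(I × (Fin i → I), Metric.closedBall (0 : (Fin i → ℝ) × ℝ) 1) :=
      ⟨coneToBall, hq.continuous⟩
    have hfac : Function.FactorsThrough (H : C(I × (Fin i → I), Y)) q := by
      rintro ⟨s, t⟩ ⟨s', t'⟩ h
      change H (s, t) = H (s', t')
      have h : coneToBall (s, t) = coneToBall (s', t') := h
      have hs : s = s' := by
        have h1 := norm_coneToBall (s, t)
        rw [h, norm_coneToBall] at h1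
        exact Subtype.ext (by simpa using h1.symm)
      subst hs
      rcases eq_or_ne s 1 with rfl | hs
      · exact (H.map_one_left t).trans (H.map_one_left t').symm
      · have hs' : 1 - (s : ℝ) ≠ 0 := fun h' =>
          hs (Subtype.ext (by simpa using (sub_eq_zero.1 h').symm))
        have h2 : cubeToSphere t = cubeToSphere t' :=
          smul_right_injective _ hs' (congrArg Subtype.val h)
        rcases cubeToSphere_eq h2 with rfl | ⟨ht, ht'⟩
        · rfl
        · exact (H.eq_snd s ht).trans (H.eq_snd s ht').symm
    let G : C(Metric.closedBall (0 : (Fin i → ℝ) × ℝ) 1, Y) :=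
      Topology.IsQuotientMap.lift (f := q) hq (H : C(I × (Fin i → I), Y)) hfac
    have hG : ∀ p, G (coneToBall p) = H p := fun p =>
      congrArg (fun F : C(_, _) => F p) (Topology.IsQuotientMap.lift_comp (f := q) hq _ hfac)
    classical
    refine ⟨fun z => if h : z ∈ Metric.closedBall 0 1 then G ⟨z, h⟩ else f (0, -1), ?_, ?_⟩
    · rw [continuousOn_iff_continuous_domRestrict]
      refine G.continuous.congr fun z => ?_
      simp [Set.domRestrict]
    · intro z hz
      have hz1 : ‖z‖ = 1 := by simpa using hz
      obtain ⟨t, rfl⟩ := exists_cubeToSphere_eq hi hz1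
      have hmem : cubeToSphere t ∈ Metric.closedBall (0 : (Fin i → ℝ) × ℝ) 1 :=
        Metric.sphere_subset_closedBall hz
      simp only [dif_pos hmem]
      have : (⟨cubeToSphere t, hmem⟩ : Metric.closedBall (0 : (Fin i → ℝ) × ℝ) 1) =
          coneToBall (0, t) := Subtype.ext (by simp [coneToBall])
      rw [this, hG]
      exact H.map_zero_left t

end Extension

/-! ### The neighborhood complex and its box maps -/

/-- The neighborhood complex of a graph with adjacency relation `R`: the non-empty finite sets of
vertices with a common neighbor. -/
def neighborComplex {V : Type*} (R : V → V → Prop) : PreAbstractSimplicialComplex V where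
  faces := {τ | τ.Nonempty ∧ ∃ w, ∀ v ∈ τ, R v w}
  isRelLowerSet_faces := by
    rintro τ ⟨hτ, w, hw⟩
    exact ⟨hτ, fun τ' hτ' hne => ⟨hne, w, fun v hv => hw v (hτ' hv)⟩⟩

/-- A map `(P, Q)` on a set `S` into the box complex of the graph `R`: two families of formal convex
combinations of vertices such that all vertices in `P z` are adjacent to all vertices in `Q z`. It
shall use finitely many vertices, so that continuity is continuity of the coordinates. -/
structure IsBoxMap {V Z : Type*} [TopologicalSpace Z] (R : V → V → Prop) (S : Set Z)
    (P Q : Z → V →₀ ℝ) : Prop where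
  left : ∀ z ∈ S, IsBarycentric (P z)
  right : ∀ z ∈ S, IsBarycentric (Q z)
  adj : ∀ z ∈ S, ∀ v ∈ (P z).support, ∀ w ∈ (Q z).support, R v w
  finite : ∃ F : Finset V, ∀ z ∈ S, (P z).support ⊆ F ∧ (Q z).support ⊆ F
  continuousOn_left : ∀ v, ContinuousOn (fun z => P z v) S
  continuousOn_right : ∀ v, ContinuousOn (fun z => Q z v) S

namespace IsBoxMap

variable {V Z Z' : Type*} [TopologicalSpace Z] [TopologicalSpace Z'] {R : V → V → Prop}
  {S T : Set Z} {P Q P' Q' : Z → V →₀ ℝ}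

theorem symm (hR : ∀ v w, R v w → R w v) (h : IsBoxMap R S P Q) : IsBoxMap R S Q P where
  left := h.right
  right := h.left
  adj := fun z hz v hv w hw => hR _ _ (h.adj z hz w hw v hv)
  finite := let ⟨F, hF⟩ := h.finite; ⟨F, fun z hz => (hF z hz).symm⟩
  continuousOn_left := h.continuousOn_right
  continuousOn_right := h.continuousOn_left

theorem comp (h : IsBoxMap R S P Q) {φ : Z' → Z} {T : Set Z'} (hφ : ContinuousOn φ T)
    (hT : Set.MapsTo φ T S) : IsBoxMap R T (fun z => P (φ z)) fun z => Q (φ z) where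
  left := fun _ hz => h.left _ (hT hz)
  right := fun _ hz => h.right _ (hT hz)
  adj := fun _ hz => h.adj _ (hT hz)
  finite := let ⟨F, hF⟩ := h.finite; ⟨F, fun _ hz => hF _ (hT hz)⟩
  continuousOn_left := fun v => (h.continuousOn_left v).comp hφ hT
  continuousOn_right := fun v => (h.continuousOn_right v).comp hφ hT

theorem congr (h : IsBoxMap R S P Q) (hP : ∀ z ∈ S, P' z = P z) (hQ : ∀ z ∈ S, Q' z = Q z) :
    IsBoxMap R S P' Q' where
  left := fun z hz => by rw [hP z hz]; exact h.left z hz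
  right := fun z hz => by rw [hQ z hz]; exact h.right z hz
  adj := fun z hz => by rw [hP z hz, hQ z hz]; exact h.adj z hz
  finite := by
    obtain ⟨F, hF⟩ := h.finite
    exact ⟨F, fun z hz => by rw [hP z hz, hQ z hz]; exact hF z hz⟩
  continuousOn_left := fun v => (h.continuousOn_left v).congr fun z hz => by rw [hP z hz]
  continuousOn_right := fun v => (h.continuousOn_right v).congr fun z hz => by rw [hQ z hz]

theorem union (hS : IsClosed S) (hT : IsClosed T) (h : IsBoxMap R S P Q)
    (h' : IsBoxMap R T P Q) : IsBoxMap R (S ∪ T) P Q where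
  left := fun z hz => hz.elim (h.left z) (h'.left z)
  right := fun z hz => hz.elim (h.right z) (h'.right z)
  adj := fun z hz => hz.elim (h.adj z) (h'.adj z)
  finite := by
    classical
    obtain ⟨F, hF⟩ := h.finite
    obtain ⟨F', hF'⟩ := h'.finite
    refine ⟨F ∪ F', fun z hz => ?_⟩
    rcases hz with hz | hz
    · exact ⟨(hF z hz).1.trans Finset.subset_union_left,
        (hF z hz).2.trans Finset.subset_union_left⟩
    · exact ⟨(hF' z hz).1.trans Finset.subset_union_right,
        (hF' z hz).2.trans Finset.subset_union_right⟩
  continuousOn_left := fun v =>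
    (h.continuousOn_left v).union_of_isClosed (h'.continuousOn_left v) hS hT
  continuousOn_right := fun v =>
    (h.continuousOn_right v).union_of_isClosed (h'.continuousOn_right v) hS hT

theorem support_left_mem (h : IsBoxMap R S P Q) {z : Z} (hz : z ∈ S) :
    (P z).support ∈ neighborComplex R := by
  obtain ⟨w, hw⟩ := (h.right z hz).support_nonempty
  exact ⟨(h.left z hz).support_nonempty, w, fun v hv => h.adj z hz v hv w hw⟩

/-- The first component of a box map is a continuous map into the neighborhood complex. -/
theorem exists_realization_map [Nonempty (Realization (neighborComplex R))]
    (h : IsBoxMap R S P Q) : ∃ f : Z → Realization (neighborComplex R), ContinuousOn f S ∧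
      ∀ z ∈ S, (f z).coord = P z := by
  classical
  let f : Z → Realization (neighborComplex R) := fun z =>
    if hz : z ∈ S then .ofCoord (P z) (h.left z hz) (h.support_left_mem hz)
    else Classical.arbitrary _
  have hf : ∀ z ∈ S, (f z).coord = P z := fun z hz => by simp [f, hz]
  refine ⟨f, ?_, hf⟩
  obtain ⟨F, hF⟩ := h.finite
  rw [continuousOn_iff_continuous_domRestrict]
  refine Realization.continuous_of_continuous_coord (F := F) (fun z => ?_) fun v => ?_
  · rw [Set.domRestrict_apply, hf z z.2]
    exact (hF z z.2).1
  · have := continuousOn_iff_continuous_domRestrict.1 (h.continuousOn_left v)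
    refine this.congr fun z => ?_
    rw [Set.domRestrict_apply, Set.domRestrict_apply, hf z z.2]

end IsBoxMap

/-! ### Lifting maps from the neighborhood complex to the box complex -/

section Core

variable {V : Type*}

/-- A threshold below the largest coordinate of any convex combination of the vertices in `F`. -/
def coreThreshold (F : Finset V) : ℝ := 1 / (2 * F.card)

/-- The convex combination `p` with all coordinates below the threshold removed. -/
def coreLeft (F : Finset V) (p : V →₀ ℝ) : V →₀ ℝ :=
  vertexAverage F (fun v => max 0 (p v - coreThreshold F)) id

/-- The weight of a set `τ` of vertices; it is positive if `τ` consists of vertices of `p` and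
contains those whose coordinate reaches the threshold. -/
def coreWeight [DecidableEq V] (F : Finset V) (p : V →₀ ℝ) (τ : Finset V) : ℝ :=
  (∏ v ∈ τ, p v) * ∏ v ∈ F \ τ, max 0 (coreThreshold F - p v)

/-- An average of the vertices `z τ`, where `z` is meant to choose common neighbors. -/
def coreRight [DecidableEq V] (F : Finset V) (z : Finset V → V) (p : V →₀ ℝ) : V →₀ ℝ :=
  vertexAverage F.powerset (coreWeight F p) z

variable {F : Finset V} {p : V →₀ ℝ}

theorem coreThreshold_pos (hp : IsBarycentric p) (hF : p.support ⊆ F) : 0 < coreThreshold F := by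
  have : 0 < F.card := Finset.card_pos.2 (hp.support_nonempty.mono hF)
  unfold coreThreshold
  positivity

theorem exists_coreThreshold_lt (hp : IsBarycentric p) (hF : p.support ⊆ F) :
    ∃ v ∈ F, coreThreshold F < p v := by
  by_contra! h
  have h1 := Finset.sum_le_card_nsmul F p _ h
  have h2 : 0 < F.card := Finset.card_pos.2 (hp.support_nonempty.mono hF)
  have h3 : (0 : ℝ) < F.card := by exact_mod_cast h2
  rw [hp.sum_of_subset hF, nsmul_eq_mul, coreThreshold] at h1
  have : (F.card : ℝ) * (1 / (2 * F.card)) = 1 / 2 := by field_simp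
  linarith

theorem exists_coreLeft_weight_pos (hp : IsBarycentric p) (hF : p.support ⊆ F) :
    ∃ v ∈ F, 0 < max 0 (p v - coreThreshold F) := by
  obtain ⟨v, hv, h⟩ := exists_coreThreshold_lt hp hF
  exact ⟨v, hv, lt_max_of_lt_right (sub_pos.2 h)⟩

theorem isBarycentric_coreLeft (hp : IsBarycentric p) (hF : p.support ⊆ F) :
    IsBarycentric (coreLeft F p) :=
  isBarycentric_vertexAverage (fun _ _ => le_max_left _ _) (exists_coreLeft_weight_pos hp hF)

theorem coreThreshold_lt_of_mem_coreLeft {v : V} (hv : v ∈ (coreLeft F p).support) :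
    coreThreshold F < p v := by
  obtain ⟨v, -, hw, rfl⟩ := exists_of_mem_support_vertexAverage hv
  by_contra h
  exact hw (max_eq_left (by simp only [id] at h; linarith))

theorem support_coreLeft_subset (hp : IsBarycentric p) (hF : p.support ⊆ F) :
    (coreLeft F p).support ⊆ p.support := fun _ hv =>
  hp.mem_support_iff.2 ((coreThreshold_pos hp hF).trans (coreThreshold_lt_of_mem_coreLeft hv))

theorem continuous_coreLeft_apply {X : Type*} [TopologicalSpace X] {p : X → V →₀ ℝ}
    (hb : ∀ x, IsBarycentric (p x)) (hF : ∀ x, (p x).support ⊆ F)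
    (hp : ∀ v, Continuous fun x => p x v) (v : V) : Continuous fun x => coreLeft F (p x) v := by
  refine continuous_vertexAverage_apply (w := fun x v => max 0 (p x v - coreThreshold F))
    (fun u _ => ?_) (fun x => (Finset.sum_pos' (fun _ _ => le_max_left _ _)
      (exists_coreLeft_weight_pos (hb x) (hF x))).ne') v
  have := hp u
  fun_prop

variable [DecidableEq V]

theorem coreWeight_nonneg (hp : IsBarycentric p) (τ : Finset V) : 0 ≤ coreWeight F p τ :=
  mul_nonneg (Finset.prod_nonneg fun v _ => hp.nonneg v)
    (Finset.prod_nonneg fun _ _ => le_max_left _ _)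

theorem exists_coreWeight_pos (hp : IsBarycentric p) (hF : p.support ⊆ F) :
    ∃ τ ∈ F.powerset, 0 < coreWeight F p τ := by
  refine ⟨F.filter fun v => coreThreshold F ≤ p v, Finset.mem_powerset.2 (Finset.filter_subset _ _),
    mul_pos (Finset.prod_pos fun v hv => ?_) (Finset.prod_pos fun v hv => ?_)⟩
  · exact (coreThreshold_pos hp hF).trans_le (Finset.mem_filter.1 hv).2
  · simp only [Finset.mem_sdiff, Finset.mem_filter, not_and, not_le] at hv
    exact lt_max_of_lt_right (sub_pos.2 (hv.2 hv.1))

theorem isBarycentric_coreRight (hp : IsBarycentric p) (hF : p.support ⊆ F) (z : Finset V → V) :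
    IsBarycentric (coreRight F z p) :=
  isBarycentric_vertexAverage (fun _ _ => coreWeight_nonneg hp _) (exists_coreWeight_pos hp hF)

theorem coreLeft_adj_coreRight {R : V → V → Prop} {z : Finset V → V}
    (hz : ∀ τ ∈ neighborComplex R, ∀ v ∈ τ, R v (z τ)) (hp : IsBarycentric p)
    (hF : p.support ⊆ F) (hK : p.support ∈ neighborComplex R) {v w : V}
    (hv : v ∈ (coreLeft F p).support) (hw : w ∈ (coreRight F z p).support) : R v w := by
  obtain ⟨τ, -, hτ, rfl⟩ := exists_of_mem_support_vertexAverage hw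
  have h1 : τ ⊆ p.support := fun u hu => Finsupp.mem_support_iff.2
    (Finset.prod_ne_zero_iff.1 (left_ne_zero_of_mul hτ) u hu)
  have h2 : v ∈ τ := by
    by_contra h
    have hvF : v ∈ F \ τ := Finset.mem_sdiff.2 ⟨hF (support_coreLeft_subset hp hF hv), h⟩
    refine Finset.prod_ne_zero_iff.1 (right_ne_zero_of_mul hτ) v hvF (max_eq_left ?_)
    linarith [coreThreshold_lt_of_mem_coreLeft hv]
  exact hz τ (((neighborComplex R).isRelLowerSet_faces hK).2 h1 ⟨v, h2⟩) v h2

theorem continuous_coreRight_apply {X : Type*} [TopologicalSpace X] {p : X → V →₀ ℝ}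
    (hb : ∀ x, IsBarycentric (p x)) (hF : ∀ x, (p x).support ⊆ F) (z : Finset V → V)
    (hp : ∀ v, Continuous fun x => p x v) (v : V) : Continuous fun x => coreRight F z (p x) v := by
  refine continuous_vertexAverage_apply (w := fun x => coreWeight F (p x)) (fun τ _ => ?_)
    (fun x => (Finset.sum_pos' (fun _ _ => coreWeight_nonneg (hb x) _)
      (exists_coreWeight_pos (hb x) (hF x))).ne') v
  unfold coreWeight
  refine (continuous_finsetProd _ fun u _ => hp u).mul (continuous_finsetProd _ fun u _ => ?_)
  have := hp u
  fun_prop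

end Core

/-! ### Extension of box maps and the chromatic bound -/

namespace IsBoxMap

variable {V Z : Type*} {R : V → V → Prop}

/-- The lift of a map into the neighborhood complex to a box map. -/
theorem core [TopologicalSpace Z] [DecidableEq V] {S : Set Z}
    {h : Z → Realization (neighborComplex R)} (hh : ContinuousOn h S) {F : Finset V}
    (hF : ∀ z ∈ S, (h z).coord.support ⊆ F) {c : Finset V → V}
    (hc : ∀ τ ∈ neighborComplex R, ∀ v ∈ τ, R v (c τ)) :
    IsBoxMap R S (fun z => coreLeft F (h z).coord) fun z => coreRight F c (h z).coord where
  left := fun z hz => isBarycentric_coreLeft (h z).isBarycentric (hF z hz)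
  right := fun z hz => isBarycentric_coreRight (h z).isBarycentric (hF z hz) c
  adj := fun z hz v hv w hw =>
    coreLeft_adj_coreRight hc (h z).isBarycentric (hF z hz) (h z).support_mem hv hw
  finite := ⟨F ∪ F.powerset.image c, fun z hz =>
    ⟨((support_coreLeft_subset (h z).isBarycentric (hF z hz)).trans (hF z hz)).trans
      Finset.subset_union_left,
      support_vertexAverage_subset.trans Finset.subset_union_right⟩⟩
  continuousOn_left := fun v => by
    rw [continuousOn_iff_continuous_domRestrict] at hh ⊢
    exact continuous_coreLeft_apply (fun z : S => (h z).isBarycentric) (fun z : S => hF z z.2)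
      (fun v => (Realization.continuous_coord v).comp hh) v
  continuousOn_right := fun v => by
    rw [continuousOn_iff_continuous_domRestrict] at hh ⊢
    exact continuous_coreRight_apply (fun z : S => (h z).isBarycentric) (fun z : S => hF z z.2) c
      (fun v => (Realization.continuous_coord v).comp hh) v

/-- The straight homotopies from the lift of the first component of a box map `(P, Q)` back to
`(P, Q)`: while `a` runs from zero to one the second component moves to `Q`, thereafter `b` moves
the first component to `P`. -/
theorem homotopy [TopologicalSpace Z] [DecidableEq V] {S : Set Z}
    {h : Z → Realization (neighborComplex R)} (hh : ContinuousOn h S) {F : Finset V}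
    (hF : ∀ z ∈ S, (h z).coord.support ⊆ F) {c : Finset V → V}
    (hc : ∀ τ ∈ neighborComplex R, ∀ v ∈ τ, R v (c τ)) {P Q : Z → V →₀ ℝ}
    (hPQ : IsBoxMap R S P Q) (hP : ∀ z ∈ S, (h z).coord = P z) {a b : Z → ℝ}
    (ha : ContinuousOn a S) (hb : ContinuousOn b S) (ha01 : ∀ z ∈ S, a z ∈ Set.Icc 0 1)
    (hb01 : ∀ z ∈ S, b z ∈ Set.Icc 0 1) (hab : ∀ z ∈ S, b z = 0 ∨ a z = 1) :
    IsBoxMap R S (fun z => (1 - b z) • coreLeft F (h z).coord + b z • P z)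
      fun z => (1 - a z) • coreRight F c (h z).coord + a z • Q z := by
  have hcore := IsBoxMap.core hh hF hc
  have hsub : ∀ z ∈ S, (coreLeft F (h z).coord).support ⊆ (P z).support := fun z hz => by
    rw [← hP z hz]
    exact support_coreLeft_subset (h z).isBarycentric (hF z hz)
  constructor
  · exact fun z hz => (hcore.left z hz).combination (hPQ.left z hz) (by linarith [(hb01 z hz).2])
      (hb01 z hz).1 (by ring)
  · exact fun z hz => (hcore.right z hz).combination (hPQ.right z hz) (by linarith [(ha01 z hz).2])
      (ha01 z hz).1 (by ring)
  · intro z hz v hv w hw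
    rcases mem_support_combination hw with ⟨hw1, hw2⟩ | ⟨-, hw2⟩
    · rcases mem_support_combination hv with ⟨-, hv2⟩ | ⟨hv1, -⟩
      · exact hcore.adj z hz v hv2 w hw2
      · rcases hab z hz with h' | h'
        · exact absurd h' hv1
        · exact absurd (by rw [h', sub_self]) hw1
    · rcases mem_support_combination hv with ⟨-, hv2⟩ | ⟨-, hv2⟩
      · exact hPQ.adj z hz v (hsub z hz hv2) w hw2
      · exact hPQ.adj z hz v hv2 w hw2
  · obtain ⟨F₁, h₁⟩ := hcore.finite
    obtain ⟨F₂, h₂⟩ := hPQ.finite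
    refine ⟨F₁ ∪ F₂, fun z hz => ⟨fun v hv => ?_, fun v hv => ?_⟩⟩
    · rcases mem_support_combination hv with ⟨-, hv2⟩ | ⟨-, hv2⟩
      · exact Finset.mem_union_left _ ((h₁ z hz).1 hv2)
      · exact Finset.mem_union_right _ ((h₂ z hz).1 hv2)
    · rcases mem_support_combination hv with ⟨-, hv2⟩ | ⟨-, hv2⟩
      · exact Finset.mem_union_left _ ((h₁ z hz).2 hv2)
      · exact Finset.mem_union_right _ ((h₂ z hz).2 hv2)
  · intro v
    simp only [Finsupp.add_apply, Finsupp.smul_apply, smul_eq_mul]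
    exact ((continuousOn_const.sub hb).mul (hcore.continuousOn_left v)).add
      (hb.mul (hPQ.continuousOn_left v))
  · intro v
    simp only [Finsupp.add_apply, Finsupp.smul_apply, smul_eq_mul]
    exact ((continuousOn_const.sub ha).mul (hcore.continuousOn_right v)).add
      (ha.mul (hPQ.continuousOn_right v))

/-- A box map on the sphere extends over the ball as soon as its first component does. The lift of
the extension fills the ball of radius `1 / 3`, and the straight homotopies fill the shell. -/
theorem exists_extension [NormedAddCommGroup Z] [NormedSpace ℝ Z] [ProperSpace Z]
    {P Q : Z → V →₀ ℝ} (h : IsBoxMap R (Metric.sphere 0 1) P Q)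
    {g : Z → Realization (neighborComplex R)} (hg : ContinuousOn g (Metric.closedBall 0 1))
    (hgP : ∀ z ∈ Metric.sphere 0 1, (g z).coord = P z) :
    ∃ P' Q' : Z → V →₀ ℝ, IsBoxMap R (Metric.closedBall 0 1) P' Q' ∧
      ∀ z ∈ Metric.sphere 0 1, P' z = P z ∧ Q' z = Q z := by
  classical
  obtain ⟨F, hF⟩ : ∃ F : Finset V, ∀ z ∈ Metric.closedBall 0 1, (g z).coord.support ⊆ F := by
    have : CompactSpace (Metric.closedBall (0 : Z) 1) :=
      isCompact_iff_compactSpace.1 (isCompact_closedBall _ _)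
    obtain ⟨F, hF⟩ := Realization.exists_finset_support_subset
      (continuousOn_iff_continuous_domRestrict.1 hg)
    exact ⟨F, fun z hz => hF ⟨z, hz⟩⟩
  obtain ⟨c, hc⟩ : ∃ c : Finset V → V, ∀ τ ∈ neighborComplex R, ∀ v ∈ τ, R v (c τ) := by
    obtain ⟨v₀, -⟩ := (g 0).isBarycentric.support_nonempty
    refine ⟨fun τ => if hτ : τ ∈ neighborComplex R then hτ.2.choose else v₀, fun τ hτ => ?_⟩
    simp only [dif_pos hτ]
    exact hτ.2.choose_spec
  let u : Z → Z := fun z => (max ‖z‖ (1 / 3))⁻¹ • z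
  have hmax : ∀ z : Z, 0 < max ‖z‖ (1 / 3) := fun z => lt_max_of_lt_right (by norm_num)
  have hu : Continuous u := by
    refine Continuous.smul ?_ continuous_id
    exact (continuous_norm.max continuous_const).inv₀ fun z => (hmax z).ne'
  have hu1 : ∀ z, u z ∈ Metric.closedBall (0 : Z) 1 := fun z => by
    rw [mem_closedBall_zero_iff, norm_smul, norm_inv, Real.norm_of_nonneg (hmax z).le,
      inv_mul_le_iff₀ (hmax z), mul_one]
    exact le_max_left _ _
  have hu2 : ∀ z, 1 / 3 ≤ ‖z‖ → u z ∈ Metric.sphere (0 : Z) 1 := fun z hz => by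
    have h0 : ‖z‖ ≠ 0 := by linarith
    rw [mem_sphere_zero_iff_norm, norm_smul, norm_inv, Real.norm_of_nonneg (hmax z).le,
      max_eq_left hz, inv_mul_cancel₀ h0]
  let a : Z → ℝ := fun z => min 1 (max 0 (3 * ‖z‖ - 1))
  let b : Z → ℝ := fun z => min 1 (max 0 (3 * ‖z‖ - 2))
  have ha : Continuous a := by fun_prop
  have hb : Continuous b := by fun_prop
  have hmem : ∀ r : ℝ, min 1 (max 0 r) ∈ Set.Icc (0 : ℝ) 1 := fun r =>
    ⟨le_min zero_le_one (le_max_left _ _), min_le_left _ _⟩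
  have hgu : Continuous fun z => g (u z) := hg.comp_continuous hu hu1
  have hFu : ∀ z, (g (u z)).coord.support ⊆ F := fun z => hF _ (hu1 z)
  refine ⟨fun z => (1 - b z) • coreLeft F (g (u z)).coord + b z • P (u z),
    fun z => (1 - a z) • coreRight F c (g (u z)).coord + a z • Q (u z), ?_, ?_⟩
  · have hin : IsBoxMap R (Metric.closedBall (0 : Z) (1 / 3))
        (fun z => (1 - b z) • coreLeft F (g (u z)).coord + b z • P (u z))
        fun z => (1 - a z) • coreRight F c (g (u z)).coord + a z • Q (u z) := by
      refine (IsBoxMap.core hgu.continuousOn (fun z _ => hFu z) hc).congr ?_ ?_ <;> intro z hz <;>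
        rw [mem_closedBall_zero_iff] at hz
      · have : b z = 0 := by
          simp only [b]
          rw [max_eq_left (by linarith), min_eq_right zero_le_one]
        simp [this]
      · have : a z = 0 := by
          simp only [a]
          rw [max_eq_left (by linarith), min_eq_right zero_le_one]
        simp [this]
    have hout : IsBoxMap R {z : Z | 1 / 3 ≤ ‖z‖}
        (fun z => (1 - b z) • coreLeft F (g (u z)).coord + b z • P (u z))
        fun z => (1 - a z) • coreRight F c (g (u z)).coord + a z • Q (u z) := by
      refine IsBoxMap.homotopy hgu.continuousOn (fun z _ => hFu z) hc
        (h.comp hu.continuousOn fun z hz => hu2 z hz) (fun z hz => hgP _ (hu2 z hz))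
        ha.continuousOn hb.continuousOn (fun z _ => hmem _) (fun z _ => hmem _) fun z _ => ?_
      rcases le_total (3 * ‖z‖ - 2) 0 with h' | h'
      · left
        simp only [b]
        rw [max_eq_left h', min_eq_right zero_le_one]
      · right
        simp only [a]
        exact min_eq_left (le_max_of_le_right (by linarith))
    have hall := hin.union Metric.isClosed_closedBall
      (isClosed_le continuous_const continuous_norm) hout
    refine hall.comp (φ := id) continuousOn_id fun z _ => ?_
    rcases le_total ‖z‖ (1 / 3) with h' | h'
    · exact Or.inl (mem_closedBall_zero_iff.2 h')
    · exact Or.inr h'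
  · intro z hz
    rw [mem_sphere_zero_iff_norm] at hz
    have h1 : u z = z := by
      simp only [u, hz]
      norm_num
    have h2 : a z = 1 := by
      simp only [a, hz]
      norm_num
    have h3 : b z = 1 := by
      simp only [b, hz]
      norm_num
    simp [h1, h2, h3]

/-- A box map on a ball that is odd on the boundary gives an odd box map on the next sphere: use it
on the upper hemisphere, and its antipode on the lower one. -/
theorem double {X : Type*} [NormedAddCommGroup X] (hR : ∀ v w, R v w → R w v)
    {P Q : X → V →₀ ℝ} (h : IsBoxMap R (Metric.closedBall 0 1) P Q)
    (hodd : ∀ x, ‖x‖ = 1 → P (-x) = Q x) :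
    ∃ P' Q' : X × ℝ → V →₀ ℝ, IsBoxMap R (Metric.sphere 0 1) P' Q' ∧
      ∀ z, ‖z‖ = 1 → P' (-z) = Q' z := by
  have hodd' : ∀ x, ‖x‖ = 1 → Q (-x) = P x := fun x hx => by
    rw [← hodd (-x) (by rwa [norm_neg]), neg_neg]
  have heq : ∀ (x : X) (t : ℝ), ‖(x, t)‖ = 1 → t = 0 → ‖x‖ = 1 := by
    rintro x t h rfl
    rwa [Prod.norm_mk, norm_zero, max_eq_left (norm_nonneg x)] at h
  have hfst : ∀ z : X × ℝ, ‖z‖ = 1 → ‖z.1‖ ≤ 1 := fun z hz => hz ▸ norm_fst_le z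
  refine ⟨fun z => if 0 ≤ z.2 then P z.1 else Q (-z.1),
    fun z => if 0 ≤ z.2 then Q z.1 else P (-z.1), ?_, ?_⟩
  · have hup : IsBoxMap R (Metric.sphere (0 : X × ℝ) 1 ∩ {z | 0 ≤ z.2})
        (fun z => if 0 ≤ z.2 then P z.1 else Q (-z.1))
        fun z => if 0 ≤ z.2 then Q z.1 else P (-z.1) := by
      refine (h.comp (φ := Prod.fst) continuous_fst.continuousOn ?_).congr ?_ ?_
      · intro z hz
        exact mem_closedBall_zero_iff.2 (hfst z (mem_sphere_zero_iff_norm.1 hz.1))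
      · exact fun z hz => if_pos hz.2
      · exact fun z hz => if_pos hz.2
    have hlow : IsBoxMap R (Metric.sphere (0 : X × ℝ) 1 ∩ {z | z.2 ≤ 0})
        (fun z => if 0 ≤ z.2 then P z.1 else Q (-z.1))
        fun z => if 0 ≤ z.2 then Q z.1 else P (-z.1) := by
      refine ((h.symm hR).comp (φ := fun z : X × ℝ => -z.1)
        continuous_fst.neg.continuousOn ?_).congr ?_ ?_
      · intro z hz
        rw [mem_closedBall_zero_iff, norm_neg]
        exact hfst z (mem_sphere_zero_iff_norm.1 hz.1)
      · rintro ⟨x, t⟩ ⟨hz, ht⟩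
        dsimp only
        split_ifs with h0
        · exact (hodd' x (heq x t (mem_sphere_zero_iff_norm.1 hz) (le_antisymm ht h0))).symm
        · rfl
      · rintro ⟨x, t⟩ ⟨hz, ht⟩
        dsimp only
        split_ifs with h0
        · exact (hodd x (heq x t (mem_sphere_zero_iff_norm.1 hz) (le_antisymm ht h0))).symm
        · rfl
    have hall := hup.union
      (Metric.isClosed_sphere.inter (isClosed_le continuous_const continuous_snd))
      (Metric.isClosed_sphere.inter (isClosed_le continuous_snd continuous_const)) hlow
    refine hall.comp (φ := id) continuousOn_id fun z hz => ?_
    rcases le_total 0 z.2 with h' | h'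
    · exact Or.inl ⟨hz, h'⟩
    · exact Or.inr ⟨hz, h'⟩
  · rintro ⟨x, t⟩ hz
    simp only [Prod.neg_mk, neg_neg]
    rcases lt_trichotomy t 0 with ht | rfl | ht
    · rw [if_pos (by linarith), if_neg (by linarith)]
    · rw [if_pos (by simp), if_pos le_rfl]
      exact hodd x (heq x 0 hz rfl)
    · rw [if_neg (by linarith), if_pos ht.le]

end IsBoxMap

/-- The identification of `ℝ^(i+1)` with `ℝ^i × ℝ`. -/
def splitLast {i : ℕ} (x : Fin (i + 1) → ℝ) : (Fin i → ℝ) × ℝ :=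
  (fun l => x l.castSucc, x (Fin.last i))

theorem norm_splitLast {i : ℕ} (x : Fin (i + 1) → ℝ) : ‖splitLast x‖ = ‖x‖ := by
  refine le_antisymm ?_ ?_
  · refine max_le ?_ (norm_le_pi_norm x _)
    exact (pi_norm_le_iff_of_nonneg (norm_nonneg x)).2 fun l => norm_le_pi_norm x _
  · refine (pi_norm_le_iff_of_nonneg (norm_nonneg _)).2 fun l => ?_
    induction l using Fin.lastCases with
    | last => exact norm_snd_le (splitLast x)
    | cast l => exact (norm_le_pi_norm (splitLast x).1 l).trans (norm_fst_le (splitLast x))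

section Chromatic

variable {V : Type*} {R : V → V → Prop}

/-- If the neighborhood complex is highly connected, the box complex carries odd maps of spheres,
here represented by maps of a ball that are odd on its boundary. -/
theorem exists_odd_boxMap (hR : ∀ v w, R v w → R w v) {a b : V} (hab : R a b) {k : ℕ}
    (hπ : ∀ j < k, ∀ y : Realization (neighborComplex R),
      Subsingleton (π_ j (Realization (neighborComplex R)) y)) {i : ℕ}
    (hi : i ≤ k) : ∃ P Q : (Fin i → ℝ) → V →₀ ℝ, IsBoxMap R (Metric.closedBall 0 1) P Q ∧
      ∀ x, ‖x‖ = 1 → P (-x) = Q x := by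
  classical
  have : Nonempty (Realization (neighborComplex R)) := by
    refine ⟨.ofCoord _ (.single a) ?_⟩
    rw [Finsupp.support_single _ one_ne_zero]
    exact ⟨by simp, b, by simpa using hab⟩
  induction i with
  | zero =>
    refine ⟨fun _ => .single a 1, fun _ => .single b 1,
      ⟨fun _ _ => .single a, fun _ _ => .single b, ?_, ⟨{a, b}, ?_⟩, fun _ => continuousOn_const,
        fun _ => continuousOn_const⟩, ?_⟩
    · intro z _ v hv w hw
      rw [Finset.mem_singleton.1 (Finsupp.support_single_subset hv),
        Finset.mem_singleton.1 (Finsupp.support_single_subset hw)]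
      exact hab
    · intro z _
      exact ⟨Finsupp.support_single_subset.trans (by simp),
        Finsupp.support_single_subset.trans (by simp)⟩
    · intro x hx
      rw [Subsingleton.elim x 0, norm_zero] at hx
      exact absurd hx zero_ne_one
  | succ i ih =>
    obtain ⟨P, Q, hPQ, hodd⟩ := ih (by omega)
    obtain ⟨P₁, Q₁, h₁, hodd₁⟩ := hPQ.double hR hodd
    obtain ⟨f, hf, hfP⟩ := h₁.exists_realization_map
    obtain ⟨g, hg, hgf⟩ := exists_extension_closedBall (hπ i hi) hf
    obtain ⟨P₂, Q₂, h₂, hS⟩ := h₁.exists_extension hg fun z hz => by rw [hgf z hz, hfP z hz]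
    refine ⟨fun x => P₂ (splitLast x), fun x => Q₂ (splitLast x), h₂.comp ?_ ?_, ?_⟩
    · exact Continuous.continuousOn (by unfold splitLast; fun_prop)
    · intro x hx
      rw [mem_closedBall_zero_iff] at hx ⊢
      rwa [norm_splitLast]
    · intro x hx
      have h1 : ‖splitLast x‖ = 1 := by rw [norm_splitLast, hx]
      have h2 : splitLast (-x) = -splitLast x := rfl
      dsimp only
      rw [h2, (hS _ (by simpa using h1)).1, (hS _ (by simpa using h1)).2]
      exact hodd₁ _ h1

/-- **Lovász's theorem**: the neighborhood complex of a `(k + 1)`-colorable graph with an edge has a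
non-trivial homotopy group in some degree less than `k`. -/
theorem exists_not_subsingleton_pi (hR : ∀ v w, R v w → R w v) {a b : V} (hab : R a b) {k : ℕ}
    (c : V → Fin (k + 1)) (hc : ∀ v w, R v w → c v ≠ c w) :
    ∃ j < k, ∃ y : Realization (neighborComplex R),
      ¬ Subsingleton (π_ j (Realization (neighborComplex R)) y) := by
  classical
  by_contra! hπ
  obtain ⟨P, Q, hPQ, hodd⟩ := exists_odd_boxMap hR hab hπ le_rfl
  obtain ⟨F, hF⟩ := hPQ.finite
  -- the weight of a color class in a convex combination of vertices
  let φ : (V →₀ ℝ) → Fin (k + 1) → ℝ := fun p j => ∑ v ∈ F with c v = j, p v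
  let r : (Fin k → ℝ) → Fin k → ℝ := fun x => (max 1 ‖x‖)⁻¹ • x
  have hmax : ∀ x : Fin k → ℝ, 0 < max 1 ‖x‖ := fun x => lt_max_of_lt_left one_pos
  have hrc : Continuous r := by
    have h : Continuous fun x : Fin k → ℝ => (max 1 ‖x‖)⁻¹ :=
      (continuous_const.max continuous_norm).inv₀ fun z => (hmax z).ne'
    exact h.smul continuous_id
  have hr : ∀ x, r x ∈ Metric.closedBall (0 : Fin k → ℝ) 1 := fun x => by
    rw [mem_closedBall_zero_iff, norm_smul, norm_inv, Real.norm_of_nonneg (hmax x).le,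
      inv_mul_le_iff₀ (hmax x), mul_one]
    exact le_max_right _ _
  have hr1 : ∀ x, 1 ≤ ‖x‖ → ‖r x‖ = 1 := fun x hx => by
    rw [norm_smul, norm_inv, Real.norm_of_nonneg (hmax x).le, max_eq_right hx, inv_mul_cancel₀]
    linarith
  have hrneg : ∀ x, r (-x) = -r x := fun x => by simp [r]
  let f : (Fin k → ℝ) → Fin k → ℝ := fun x j =>
    φ (P (r x)) j.castSucc - φ (Q (r x)) j.castSucc
  have hf : Continuous f := by
    refine continuous_pi fun j => Continuous.sub ?_ ?_
    · exact continuous_finsetSum _ fun v _ => (hPQ.continuousOn_left v).comp_continuous hrc hr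
    · exact continuous_finsetSum _ fun v _ => (hPQ.continuousOn_right v).comp_continuous hrc hr
  have hfodd : ∀ x, 1 ≤ ‖x‖ → f (-x) = -f x := by
    intro x hx
    have h1 := hodd _ (hr1 x hx)
    have h2 := hodd (-r x) (by rw [norm_neg]; exact hr1 x hx)
    rw [neg_neg] at h2
    funext j
    simp only [f, hrneg, h1, ← h2, Pi.neg_apply]
    ring
  obtain ⟨x, hx⟩ := exists_eq_zero_of_odd hf hfodd
  have hp := hPQ.left _ (hr x)
  have hq := hPQ.right _ (hr x)
  have hadj := hPQ.adj _ (hr x)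
  have hpF := (hF _ (hr x)).1
  have hqF := (hF _ (hr x)).2
  generalize hP' : P (r x) = p at *
  generalize hQ' : Q (r x) = q at *
  have hsum : ∀ p : V →₀ ℝ, IsBarycentric p → p.support ⊆ F → ∑ j, φ p j = 1 :=
    fun p hp hpF => by
      rw [← hp.sum_of_subset hpF]
      exact Finset.sum_fiberwise F c p
  have hcast : ∀ j : Fin k, φ p j.castSucc = φ q j.castSucc := fun j => by
    have := congrFun hx j
    simp only [f, hP', hQ', Pi.zero_apply] at this
    linarith
  have hall : ∀ j, φ p j = φ q j := by
    intro j
    induction j using Fin.lastCases with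
    | last =>
      have h1 := hsum p hp hpF
      have h2 := hsum q hq hqF
      rw [Fin.sum_univ_castSucc] at h1 h2
      simp only [hcast] at h1
      linarith
    | cast j => exact hcast j
  obtain ⟨v, hv⟩ := hp.support_nonempty
  have hpos : 0 < φ q (c v) := by
    rw [← hall]
    exact Finset.sum_pos' (fun w _ => hp.nonneg w)
      ⟨v, Finset.mem_filter.2 ⟨hpF hv, rfl⟩, hp.mem_support_iff.1 hv⟩
  obtain ⟨w, hw, hw0⟩ := Finset.exists_ne_zero_of_sum_ne_zero hpos.ne'
  exact hc v w (hadj v hv w (Finsupp.mem_support_iff.2 hw0)) (Finset.mem_filter.1 hw).2.symm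

end Chromatic

/-! ### Čech complexes of spheres and covering radii -/

namespace GeodesicSphere

variable {n : ℕ}

instance : Nonempty (GeodesicSphere n) :=
  ⟨⟨EuclideanSpace.single 0 1, by simp⟩⟩

/-- The antipodal point. -/
def antipodal (x : GeodesicSphere n) : GeodesicSphere n :=
  ⟨-x.vec, by simp [norm_vec]⟩

theorem dist_antipodal_left (x y : GeodesicSphere n) :
    dist x.antipodal y = Real.pi - dist x y := by
  rw [dist_eq, dist_eq, ← Real.arccos_neg, ← inner_neg_left]
  rfl

theorem dist_antipodal_self (x : GeodesicSphere n) : dist x.antipodal x = Real.pi := by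
  rw [dist_antipodal_left, dist_self, sub_zero]

theorem dist_le_pi (x y : GeodesicSphere n) : dist x y ≤ Real.pi := Real.arccos_le_pi _

/-- The Čech complex of the sphere is the neighborhood complex of a Borsuk graph: the antipode of a
common point of open balls of radius `π - δ` has distance greater than `δ` to their centers. -/
theorem cechComplex_eq_neighborComplex (δ : ℝ) :
    cechComplex (GeodesicSphere n) (Real.pi - δ) = neighborComplex fun x w => δ < dist x w := by
  ext τ
  refine and_congr_right fun _ => ⟨?_, ?_⟩
  · rintro ⟨z, hz⟩
    refine ⟨z.antipodal, fun x hx => ?_⟩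
    have : dist z x < Real.pi - δ := Metric.mem_ball.1 (Set.mem_iInter₂.1 hz x hx)
    change δ < dist x z.antipodal
    rw [dist_comm, dist_antipodal_left]
    linarith
  · rintro ⟨w, hw⟩
    refine ⟨w.antipodal, Set.mem_iInter₂.2 fun x hx => ?_⟩
    have : δ < dist x w := hw x hx
    rw [Metric.mem_ball, dist_antipodal_left, dist_comm]
    linarith

theorem nonempty_covering_radii {m : ℕ} (hm : 0 < m) :
    {r : ℝ | 0 ≤ r ∧ ∃ x : Fin m → GeodesicSphere n,
      ⋃ i, Metric.closedBall (x i) r = Set.univ}.Nonempty := by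
  refine ⟨Real.pi, Real.pi_pos.le, fun _ => Classical.arbitrary _, ?_⟩
  rw [Set.eq_univ_iff_forall]
  exact fun z => Set.mem_iUnion.2 ⟨⟨0, hm⟩, dist_le_pi _ _⟩

/-- Below the covering radius, any `m` points have a common neighbor in the Borsuk graph. -/
theorem exists_forall_lt_dist {m : ℕ} {δ : ℝ} (hδ : 0 ≤ δ)
    (h : δ < covRadius (GeodesicSphere n) m) {τ : Finset (GeodesicSphere n)} (hne : τ.Nonempty)
    (hτ : τ.card ≤ m) : ∃ w, ∀ x ∈ τ, δ < dist x w := by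
  have : Nonempty τ := hne.to_subtype
  obtain ⟨e⟩ : Nonempty (τ ↪ Fin m) := Function.Embedding.nonempty_of_card_le (by simpa using hτ)
  let x : Fin m → GeodesicSphere n := fun i => (Function.invFun e i : τ)
  have hx : ⋃ i, Metric.closedBall (x i) δ ≠ Set.univ := fun hcov =>
    not_le.2 h <|
    csInf_le (s := {r : ℝ | 0 ≤ r ∧ ∃ x : Fin m → GeodesicSphere n,
      ⋃ i, Metric.closedBall (x i) r = Set.univ}) ⟨0, fun r hr => hr.1⟩ ⟨hδ, x, hcov⟩
  obtain ⟨w, hw⟩ := (Set.ne_univ_iff_exists_notMem _).1 hx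
  refine ⟨w, fun y hy => ?_⟩
  obtain ⟨i, hi⟩ := Function.invFun_surjective e.injective ⟨y, hy⟩
  by_contra hcon
  refine hw (Set.mem_iUnion.2 ⟨i, ?_⟩)
  rw [Metric.mem_closedBall, dist_comm]
  simpa [x, hi] using hcon

/-- If `δ` exceeds twice the covering radius, a covering by `m` balls colors the Borsuk graph. -/
theorem exists_coloring {m : ℕ} (hm : 0 < m) {δ : ℝ}
    (h : 2 * covRadius (GeodesicSphere n) m < δ) :
    ∃ c : GeodesicSphere n → Fin m, ∀ x y, δ < dist x y → c x ≠ c y := by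
  obtain ⟨r, ⟨-, x, hx⟩, hr⟩ := exists_lt_of_csInf_lt (nonempty_covering_radii (n := n) hm)
    (show covRadius (GeodesicSphere n) m < δ / 2 by linarith)
  choose c hc using fun z => Set.mem_iUnion.1 (hx.symm ▸ Set.mem_univ z)
  refine ⟨c, fun y z hyz heq => ?_⟩
  have h1 := Metric.mem_closedBall.1 (hc y)
  have h2 := Metric.mem_closedBall'.1 (hc z)
  rw [heq] at h1
  linarith [dist_triangle y (x (c z)) z]

theorem nonempty_realization {δ : ℝ} (hδ : δ < Real.pi) :
    Nonempty (Realization (cechComplex (GeodesicSphere n) (Real.pi - δ))) := by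
  let x : GeodesicSphere n := Classical.arbitrary _
  refine ⟨.ofCoord _ (.single x) ?_⟩
  rw [Finsupp.support_single _ one_ne_zero]
  exact ⟨by simp, x, by simpa using hδ⟩

theorem isNConnected_of_lt_covRadius {δ : ℝ} (hδ : δ ∈ Set.Ioo 0 Real.pi) {k : ℕ}
    (h : δ < covRadius (GeodesicSphere n) (2 * k + 2)) :
    IsNConnected (Realization (cechComplex (GeodesicSphere n) (Real.pi - δ))) k := by
  refine ⟨nonempty_realization hδ.2, fun i hi => subsingleton_pi_of_card_le fun τ hne hτ => ?_⟩
  rw [cechComplex_eq_neighborComplex]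
  have hi' : i ≤ k := by exact_mod_cast hi
  exact ⟨hne, exists_forall_lt_dist hδ.1.le h hne (hτ.trans (by omega))⟩

theorem not_isNConnected {δ : ℝ} (hδ : δ ∈ Set.Ioo 0 Real.pi) {k : ℕ}
    (h : 2 * covRadius (GeodesicSphere n) (k + 1) < δ) {j : ℤ} (hj : (k : ℤ) - 1 ≤ j) :
    ¬ IsNConnected (Realization (cechComplex (GeodesicSphere n) (Real.pi - δ))) j := by
  rw [cechComplex_eq_neighborComplex]
  obtain ⟨c, hc⟩ := exists_coloring k.succ_pos h
  let x : GeodesicSphere n := Classical.arbitrary _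
  have hx : δ < dist x.antipodal x := by
    rw [dist_antipodal_self]
    exact hδ.2
  obtain ⟨i, hi, y, hy⟩ := exists_not_subsingleton_pi (R := fun x w => δ < dist x w)
    (fun v w h => by rwa [dist_comm]) hx c hc
  exact fun hcon => hy (hcon.2 i (by omega) y)

theorem exists_hasConnectivity_le {δ : ℝ} (hδ : δ ∈ Set.Ioo 0 Real.pi) {k : ℕ}
    (h : 2 * covRadius (GeodesicSphere n) (k + 1) < δ) :
    ∃ m : ℤ, m ≤ (k : ℤ) - 2 ∧
      HasConnectivity (Realization (cechComplex (GeodesicSphere n) (Real.pi - δ))) m := by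
  have hbdd : ∀ j : ℤ, IsNConnected (Realization (cechComplex (GeodesicSphere n) (Real.pi - δ))) j →
      j ≤ (k : ℤ) - 2 := fun j hj => by
    by_contra hcon
    exact not_isNConnected hδ h (by omega) hj
  obtain ⟨m, hm, hmax⟩ := Int.exists_greatest_of_bdd ⟨_, hbdd⟩
    ⟨-1, nonempty_realization hδ.2, fun i hi => absurd hi (by omega)⟩
  exact ⟨m, hbdd m hm, hm, hmax⟩

end GeodesicSphere

end

theorem theorem1 (n : ℕ) (hn : 1 ≤ n) (δ : ℝ) (hδ : δ ∈ Set.Ioo 0 Real.pi) :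
    (∀ k : ℕ,
      HasConnectivity (Realization (cechComplex (GeodesicSphere n) (Real.pi - δ))) ((k : ℤ) - 1) →
        covRadius (GeodesicSphere n) (2 * k + 2) ≤ δ ∧
          δ ≤ 2 * covRadius (GeodesicSphere n) (k + 1)) ∧
    (∀ k : ℕ, δ < covRadius (GeodesicSphere n) (2 * k + 2) →
      IsNConnected (Realization (cechComplex (GeodesicSphere n) (Real.pi - δ))) (k : ℤ)) ∧
    (∀ k : ℕ, 1 ≤ k → 2 * covRadius (GeodesicSphere n) (k + 1) < δ →
      ∃ m : ℤ, m ≤ (k : ℤ) - 2 ∧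
        HasConnectivity (Realization (cechComplex (GeodesicSphere n) (Real.pi - δ))) m) := by
  refine ⟨fun k hk => ⟨?_, ?_⟩, fun k => GeodesicSphere.isNConnected_of_lt_covRadius hδ,
    fun k _ => GeodesicSphere.exists_hasConnectivity_le hδ⟩
  · by_contra! h
    have := hk.2 (GeodesicSphere.isNConnected_of_lt_covRadius hδ h)
    omega
  · by_contra! h
    obtain ⟨m, hm, hmax⟩ := GeodesicSphere.exists_hasConnectivity_le hδ h
    have := hk.unique hmax
    omega
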